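/- Let $X$ be a connected complex manifold (finite-dimensional, Hausdorff and second countable). Call a holomorphic vector field on $X$ complete if through every point of $X$ there is a holomorphic integral curve defined for all complex times $t\in\mathbb{C}$. Suppose that there is a set of complete holomorphic vector fields on $X$ that span the tangent space $T_xX$ at every point $x\in X$. Then there is a finite set of complete holomorphic vector fields on $X$ that span $T_xX$ at every point $x\in X$. -/

import Mathlib

open scoped Manifold ContDiff

section HolomorphicVectorFields

variable {E : Type*} [NormedAddCommGroup E] [NormedSpace ℂ E]
  {X : Type*} [TopologicalSpace X] [ChartedSpace E X]

/-- A vector field on the complex manifold `X` is holomorphic if it is holomorphic as a map from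
`X` into the holomorphic tangent bundle (`ω` is analyticity over `ℂ`). -/
def IsHolomorphicVectorField [IsManifold 𝓘(ℂ, E) ω X]
    (v : (x : X) → TangentSpace 𝓘(ℂ, E) x) : Prop :=
  ContMDiff 𝓘(ℂ, E) 𝓘(ℂ, E).tangent ω
    (fun x => (⟨x, v x⟩ : TangentBundle 𝓘(ℂ, E) X))

/-- `γ : ℂ → X` is an entire integral curve of `v`: it is complex differentiable at every complex
time `t`, and its derivative at `t` is `v (γ t)`. -/
def IsEntireIntegralCurve (γ : ℂ → X) (v : (x : X) → TangentSpace 𝓘(ℂ, E) x) : Prop :=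
  ∀ t : ℂ, HasMFDerivAt 𝓘(ℂ, ℂ) 𝓘(ℂ, E) γ t
    ((1 : ℂ →L[ℂ] ℂ).smulRight (v (γ t)) : ℂ →L[ℂ] TangentSpace 𝓘(ℂ, E) (γ t))

/-- A vector field is complete if through every point there is an integral curve that is
defined for all complex times. -/
def IsCompleteVectorField (v : (x : X) → TangentSpace 𝓘(ℂ, E) x) : Prop :=
  ∀ x : X, ∃ γ : ℂ → X, γ 0 = x ∧ IsEntireIntegralCurve γ v

/-- The set `S` of vector fields spans every tangent space, over `ℂ`. -/
def SpansEachTangentSpace (S : Set ((x : X) → TangentSpace 𝓘(ℂ, E) x)) : Prop :=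
  ∀ x : X, Submodule.span ℂ ((fun v : (x : X) → TangentSpace 𝓘(ℂ, E) x => v x) '' S) = ⊤

end HolomorphicVectorFields

open scoped Topology

/-! Let `n = dim X`. Choose `n` fields of `S` that span at one point. They fail to span on the zero
locus `A` of a holomorphic determinant, and `A` has empty interior by the identity theorem. If `φ`
is a holomorphic automorphism, the pullbacks of these fields by `φ` are again holomorphic and
complete, and they span at `x` as soon as `φ x ∉ A`. So it suffices to find automorphisms `φ 0, …, φ
n` such that no point is sent into `A` by all of them: `n + 1` hypersurfaces in general position in
dimension `n` have no common point.

General position is obtained from Baire's theorem. Pairs `(φ, φ⁻¹)` form a closed subset of `C(X, X)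
× C(X, X)`, hence a completely metrizable space, and `A` is covered by countably many compact pieces
of smooth hypersurfaces (`exists_countable_cover_setOf_span_ne_top`). At each point of a piece some
field of `S` is transverse to it, because `S` spans. Composing `φ j` with the time-`t j` flow of
such a field, a nearby point `x` hits the `j`-th piece only if `t j` is a crossing time depending
holomorphically on `x`. The bad parameters are thus the image of an open set of `ℂ^n` in `ℂ^(n+1)`,
and its complement is dense (`exists_perturbation_avoiding`).

Completeness only supplies curves, one starting point at a time. Joint holomorphy of the flow comes
from the Lie series, whose locally uniform limit is holomorphic by Osgood's lemma. -/

open Metric Set Filter Topology MeasureTheory in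
theorem torusMap_mem_closedBall {n : ℕ} (c : Fin n → ℂ) {r : ℝ} (hr : 0 ≤ r) (θ : Fin n → ℝ) :
    torusMap c (fun _ => r) θ ∈ Metric.closedBall c r := by
  rw [mem_closedBall, dist_pi_le_iff hr]
  intro i
  rw [dist_eq_norm, torusMap]
  simp [Complex.norm_exp_ofReal_mul_I, abs_of_nonneg hr]

theorem torusMap_sub_ne_zero {n : ℕ} {c z : Fin n → ℂ} {r : ℝ} (hz : z ∈ Metric.ball c r)
    (θ : Fin n → ℝ) (i : Fin n) : torusMap c (fun _ => r) θ i - z i ≠ 0 := by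
  intro h
  have hr : 0 < r := dist_nonneg.trans_lt hz
  have h1 : dist (z i) (c i) < r := (dist_le_pi_dist z c i).trans_lt hz
  rw [← sub_eq_zero.1 h, dist_eq_norm, torusMap] at h1
  simp [Complex.norm_exp_ofReal_mul_I, abs_of_pos hr] at h1

theorem continuous_torusMap {n : ℕ} (c : Fin n → ℂ) (R : Fin n → ℝ) :
    Continuous (torusMap c R) := by
  unfold torusMap
  fun_prop

/-! ### Cauchy's integral formula on polydiscs -/

section Cauchy

variable {F : Type*} [NormedAddCommGroup F] [NormedSpace ℂ F]

theorem torusIntegrable_cauchy_kernel_smul {n : ℕ} {c z : Fin n → ℂ} {r : ℝ}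
    (hz : z ∈ Metric.ball c r) {f : (Fin n → ℂ) → F} (hf : ContinuousOn f (Metric.closedBall c r)) :
    TorusIntegrable (fun ζ => (∏ i, (ζ i - z i)⁻¹) • f ζ) c (fun _ => r) := by
  have hr : 0 < r := dist_nonneg.trans_lt hz
  apply Continuous.integrableOn_Icc
  refine Continuous.smul (continuous_finsetProd _ fun i _ => Continuous.inv₀ ?_ fun θ =>
    torusMap_sub_ne_zero hz θ i) ?_
  · exact ((continuous_apply i).comp (continuous_torusMap c fun _ => r)).fun_sub continuous_const
  · exact hf.comp_continuous (continuous_torusMap c _) fun θ => torusMap_mem_closedBall c hr.le θ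

/-- **Cauchy's integral formula on a polydisc**, for functions that are continuous and holomorphic
along every complex line. -/
theorem torusIntegral_cauchy_kernel_smul [CompleteSpace F] {r : ℝ} {n : ℕ} :
    ∀ {c z : Fin n → ℂ} {f : (Fin n → ℂ) → F}, z ∈ Metric.ball c r →
    ContinuousOn f (Metric.closedBall c r) →
    (∀ ζ ∈ Metric.closedBall c r, ∀ v, DifferentiableAt ℂ (fun w : ℂ => f (ζ + w • v)) 0) →
    torusIntegral (fun ζ => (∏ i, (ζ i - z i)⁻¹) • f ζ) c (fun _ => r)
      = (2 * Real.pi * Complex.I : ℂ) ^ n • f z := by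
  induction n with
  | zero =>
    intro c z f _ _ _
    rw [torusIntegral_dim0]
    simp [Subsingleton.elim c z]
  | succ n ih =>
    intro c z f hz hc hd
    have hr : 0 < r := dist_nonneg.trans_lt hz
    rw [torusIntegral_succ (torusIntegrable_cauchy_kernel_smul hz hc)]
    have hz0 : z 0 ∈ Metric.ball (c 0) r := (dist_le_pi_dist z c 0).trans_lt hz
    have hzt : z ∘ Fin.succ ∈ Metric.ball (c ∘ Fin.succ) r :=
      (dist_pi_lt_iff hr).2 fun i => (dist_le_pi_dist z c i.succ).trans_lt hz
    have hmem : ∀ x ∈ Metric.closedBall (c 0) r, ∀ y ∈ Metric.closedBall (c ∘ Fin.succ) r,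
        (Fin.cons x y : Fin (n + 1) → ℂ) ∈ Metric.closedBall c r := by
      intro x hx y hy
      refine (dist_pi_le_iff hr.le).2 fun i => ?_
      refine Fin.cases ?_ (fun j => ?_) i
      · simpa using hx
      · simpa using (dist_le_pi_dist y (c ∘ Fin.succ) j).trans hy
    have hcons : ∀ x : ℂ, Continuous fun y : Fin n → ℂ => (Fin.cons x y : Fin (n + 1) → ℂ) :=
      fun x => continuous_pi fun i => by
        refine Fin.cases ?_ (fun j => ?_) i
        · simpa using continuous_const
        · simpa using continuous_apply j
    -- With the first coordinate frozen, the inner integral is the induction hypothesis; the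
    -- one-variable Cauchy formula then handles the outer circle.
    have hinner : ∀ x ∈ Metric.closedBall (c 0) r,
        torusIntegral (fun y : Fin n → ℂ => (∏ i, ((Fin.cons x y : Fin (n + 1) → ℂ) i - z i)⁻¹) •
          f (Fin.cons x y)) (c ∘ Fin.succ) (fun _ => r)
        = (2 * Real.pi * Complex.I : ℂ) ^ n • (x - z 0)⁻¹ • f (Fin.cons x (z ∘ Fin.succ)) := by
      intro x hx
      have h1 := ih (f := fun y => f (Fin.cons x y)) hzt
        (hc.comp (hcons x).continuousOn (fun y hy => hmem x hx y hy)) (by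
          intro ζ hζ v
          have h2 := hd _ (hmem x hx ζ hζ) (Fin.cons 0 v)
          refine h2.congr_of_eventuallyEq (Filter.Eventually.of_forall fun w => ?_)
          dsimp only
          congr 1
          ext i
          refine Fin.cases ?_ (fun j => ?_) i <;> simp)
      rw [smul_comm, ← h1, ← torusIntegral_smul]
      congr 1
      ext y
      rw [Fin.prod_univ_succ, mul_smul]
      simp only [Fin.cons_zero, Fin.cons_succ, Function.comp]
    have h3 : (∮ x in C(c 0, r), torusIntegral (fun y : Fin n → ℂ =>
        (∏ i, ((Fin.cons x y : Fin (n + 1) → ℂ) i - z i)⁻¹) •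
          f (Fin.cons x y)) (c ∘ Fin.succ) (fun _ => r))
        = ∮ x in C(c 0, r), (2 * Real.pi * Complex.I : ℂ) ^ n •
            (x - z 0)⁻¹ • f (Fin.cons x (z ∘ Fin.succ)) :=
      circleIntegral.integral_congr hr.le fun x hx => hinner x (Metric.sphere_subset_closedBall hx)
    have h4 : DifferentiableOn ℂ (fun x => f (Fin.cons x (z ∘ Fin.succ)))
        (Metric.closedBall (c 0) r) := by
      intro x hx
      have h5 := hd _ (hmem x hx _ (Metric.ball_subset_closedBall hzt)) (Fin.cons 1 0)
      have h6 : DifferentiableAt ℂ (fun x' : ℂ => x' - x) x := by fun_prop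
      have h7 := DifferentiableAt.comp x (f := fun x' : ℂ => x' - x) (by simpa using h5) h6
      refine (h7.congr_of_eventuallyEq (Filter.Eventually.of_forall fun w => ?_)).differentiableWithinAt
      simp only [Function.comp]
      congr 1
      ext i
      refine Fin.cases ?_ (fun j => ?_) i <;> simp
    refine h3.trans ?_
    rw [circleIntegral.integral_smul, h4.circleIntegral_sub_inv_smul hz0, pow_succ, smul_smul,
      show (Fin.cons (z 0) (z ∘ Fin.succ) : Fin (n + 1) → ℂ) = z from Fin.cons_self_tail z]

/-- The pairing of continuous scalar functions on a compact space with an `F`-valued one. -/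
theorem exists_continuousLinearMap_eq_integral_smul {K : Type*} [TopologicalSpace K]
    [CompactSpace K] [MeasurableSpace K] [BorelSpace K] [SecondCountableTopology K]
    (μ : MeasureTheory.Measure K)
    [MeasureTheory.IsFiniteMeasure μ] (g : C(K, F)) :
    ∃ L : C(K, ℂ) →L[ℂ] F, ∀ a, L a = ∫ x, a x • g x ∂μ := by
  have hint : ∀ a : C(K, ℂ), MeasureTheory.Integrable (fun x => a x • g x) μ := fun a =>
    (a.continuous.smul g.continuous).integrable_of_hasCompactSupport
      (HasCompactSupport.of_compactSpace _)
  refine ⟨LinearMap.mkContinuous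
    { toFun := fun a => ∫ x, a x • g x ∂μ
      map_add' := fun a b => ?_
      map_smul' := fun k a => ?_ } (‖g‖ * μ.real Set.univ) fun a => ?_, fun a => rfl⟩
  · rw [← MeasureTheory.integral_add (hint a) (hint b)]
    simp [add_smul]
  · simp [mul_smul, MeasureTheory.integral_smul]
  · refine (MeasureTheory.norm_integral_le_of_norm_le_const (C := ‖a‖ * ‖g‖)
      (Filter.Eventually.of_forall fun x => ?_)).trans (le_of_eq (by ring))
    rw [norm_smul]
    exact mul_le_mul (a.norm_coe_le_norm x) (g.norm_coe_le_norm x) (norm_nonneg _) (norm_nonneg _)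

end Cauchy

/-! ### Osgood's lemma and locally uniform limits -/

section Osgood

variable {F : Type*} [NormedAddCommGroup F] [NormedSpace ℂ F] [CompleteSpace F]

/-- Cauchy's formula writes `f z` as a continuous linear map `L` applied to the kernel, viewed as an
element of the Banach algebra `C(K, ℂ)`, with `K` the box of angles. The kernel is a product of
inverses of units affine in `z`, and inversion is analytic in a Banach algebra, so no power series
has to be expanded. -/
theorem analyticAt_of_differentiableAt_lines_pi {n : ℕ} {f : (Fin n → ℂ) → F} {c : Fin n → ℂ}
    {r : ℝ} (hr : 0 < r) (hc : ContinuousOn f (Metric.closedBall c r))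
    (hd : ∀ ζ ∈ Metric.closedBall c r, ∀ v, DifferentiableAt ℂ (fun w : ℂ => f (ζ + w • v)) 0) :
    AnalyticAt ℂ f c := by
  let K := Set.Icc (0 : Fin n → ℝ) fun _ => 2 * Real.pi
  let T : C(K, Fin n → ℂ) := ⟨fun θ => torusMap c (fun _ => r) θ.1,
    (continuous_torusMap c _).comp continuous_subtype_val⟩
  let g : C(K, F) := ⟨fun θ => (∏ i, (r : ℂ) * Complex.exp (θ.1 i * Complex.I) * Complex.I) •
      f (torusMap c (fun _ => r) θ.1), by
    refine Continuous.smul ?_ ?_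
    · refine continuous_finsetProd _ fun i _ => ?_
      have h : Continuous fun θ : K => θ.1 i := (continuous_apply i).comp continuous_subtype_val
      exact (continuous_const.mul (Complex.continuous_exp.comp
        ((Complex.continuous_ofReal.comp h).mul continuous_const))).mul continuous_const
    · exact hc.comp_continuous T.continuous fun θ => torusMap_mem_closedBall c hr.le θ.1⟩
  have hfin : MeasureTheory.IsFiniteMeasure
      (MeasureTheory.volume.comap (Subtype.val : K → Fin n → ℝ)) := ⟨by
    rw [(MeasurableEmbedding.subtype_coe measurableSet_Icc).comap_apply]
    rw [Set.image_univ, Subtype.range_coe]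
    exact isCompact_Icc.measure_lt_top⟩
  obtain ⟨L, hL⟩ := exists_continuousLinearMap_eq_integral_smul
    (MeasureTheory.volume.comap (Subtype.val : K → Fin n → ℝ)) g
  let u : Fin n → (Fin n → ℂ) → C(K, ℂ) := fun i z =>
    ⟨fun θ => T θ i, (continuous_apply i).comp T.continuous⟩ - z i • 1
  have hu : ∀ i, AnalyticAt ℂ (u i) c := fun i =>
    analyticAt_const.sub (((ContinuousLinearMap.proj (R := ℂ) (φ := fun _ : Fin n => ℂ) i).smulRight
      (1 : C(K, ℂ))).analyticAt c)
  have hunit : ∀ i, ∀ z ∈ Metric.ball c r, IsUnit (u i z) := fun i z hz => by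
    rw [ContinuousMap.isUnit_iff_forall_ne_zero]
    intro θ
    simpa [u, T] using torusMap_sub_ne_zero hz θ.1 i
  have hinv : ∀ i, ∀ z ∈ Metric.ball c r, ∀ θ, (Ring.inverse (u i z)) θ = (T θ i - z i)⁻¹ := by
    intro i z hz θ
    have h1 := congrArg (fun a : C(K, ℂ) => a θ) (Ring.mul_inverse_cancel _ (hunit i z hz))
    simp only [ContinuousMap.mul_apply, ContinuousMap.one_apply] at h1
    rw [eq_inv_of_mul_eq_one_right h1]
    simp [u]
  have hk : AnalyticAt ℂ (fun z => ((2 * Real.pi * Complex.I : ℂ) ^ n)⁻¹ •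
      L (∏ i, Ring.inverse (u i z))) c := by
    refine AnalyticAt.const_smul (AnalyticAt.comp (L.analyticAt _) ?_)
    refine Finset.analyticAt_fun_prod _ fun i _ => ?_
    obtain ⟨w, hw⟩ := hunit i c (Metric.mem_ball_self hr)
    exact AnalyticAt.comp (hw ▸ analyticAt_inverse w) (hu i)
  refine hk.congr ?_
  filter_upwards [Metric.ball_mem_nhds c hr] with z hz
  rw [inv_smul_eq_iff₀ (pow_ne_zero _ Complex.two_pi_I_ne_zero),
    ← torusIntegral_cauchy_kernel_smul hz hc hd, hL, torusIntegral,
    ← MeasureTheory.integral_subtype_comap measurableSet_Icc]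
  refine MeasureTheory.integral_congr_ae (Filter.Eventually.of_forall fun θ => ?_)
  simp only [ContinuousMap.prod_apply, hinv _ z hz, g, ContinuousMap.coe_mk, T]
  rw [smul_comm]

variable {E : Type*} [NormedAddCommGroup E] [NormedSpace ℂ E] [FiniteDimensional ℂ E]

/-- **Osgood's lemma**: a continuous function on an open subset of a finite-dimensional complex
vector space that is holomorphic along every complex line is analytic. -/
theorem analyticOnNhd_of_differentiableAt_lines {f : E → F} {U : Set E} (hU : IsOpen U)
    (hc : ContinuousOn f U)
    (hd : ∀ x ∈ U, ∀ v, DifferentiableAt ℂ (fun w : ℂ => f (x + w • v)) 0) :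
    AnalyticOnNhd ℂ f U := by
  intro x hx
  let e : E ≃L[ℂ] (Fin (Module.finrank ℂ E) → ℂ) := ContinuousLinearEquiv.ofFinrankEq (by simp)
  have hV : e.symm ⁻¹' U ∈ 𝓝 (e x) := (hU.preimage e.symm.continuous).mem_nhds (by simpa using hx)
  obtain ⟨r, hr, hball⟩ := Metric.nhds_basis_closedBall.mem_iff.1 hV
  have h1 : AnalyticAt ℂ (f ∘ e.symm) (e x) :=
    analyticAt_of_differentiableAt_lines_pi hr
      (hc.comp e.symm.continuous.continuousOn fun y hy => hball hy) fun ζ hζ v => by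
        simpa using hd _ (hball hζ) (e.symm v)
  have h2 : AnalyticAt ℂ ((f ∘ e.symm) ∘ e) x :=
    AnalyticAt.comp h1 (e.analyticAt x)
  simpa [Function.comp_def] using h2

/-- A locally uniform limit of holomorphic functions of several variables is holomorphic. -/
theorem TendstoLocallyUniformlyOn.analyticOnNhd_of_finiteDimensional {ι : Type*} {l : Filter ι}
    [l.NeBot] {f : ι → E → F} {g : E → F} {U : Set E} (hfg : TendstoLocallyUniformlyOn f g l U)
    (hU : IsOpen U) (hf : ∀ᶠ i in l, DifferentiableOn ℂ (f i) U) : AnalyticOnNhd ℂ g U := by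
  refine analyticOnNhd_of_differentiableAt_lines hU
    (hfg.continuousOn (hf.mono fun i hi => hi.continuousOn).frequently) fun x hx v => ?_
  have hline : Continuous fun w : ℂ => x + w • v := by fun_prop
  have hV : IsOpen ((fun w : ℂ => x + w • v) ⁻¹' U) := hU.preimage hline
  have h1 := hfg.comp (fun w : ℂ => x + w • v) (Set.mapsTo_preimage _ _) hline.continuousOn
  refine (h1.differentiableOn (hf.mono fun i hi => ?_) hV).differentiableAt
    (hV.mem_nhds (by simpa using hx))
  exact hi.comp (by fun_prop) (Set.mapsTo_preimage _ _)

end Osgood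

/-! ### Complete metrizability of spaces of continuous maps -/

section Polish

variable {X : Type*} [TopologicalSpace X]

/-- A locally compact dense subspace of a Hausdorff space is open. -/
theorem IsDenseEmbedding.isOpen_range_of_locallyCompactSpace {Y : Type*}
    [TopologicalSpace Y] [T2Space Y] [LocallyCompactSpace X] {i : X → Y}
    (hi : IsDenseEmbedding i) : IsOpen (Set.range i) := by
  rw [isOpen_iff_mem_nhds]
  rintro _ ⟨x, rfl⟩
  obtain ⟨K, hK, hxK⟩ := exists_compact_mem_nhds x
  rw [hi.toIsDenseInducing.toIsInducing.nhds_eq_comap, Filter.mem_comap] at hxK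
  obtain ⟨t, ht, htK⟩ := hxK
  obtain ⟨o, hot, ho, hxo⟩ := mem_nhds_iff.1 ht
  refine Filter.mem_of_superset (ho.mem_nhds hxo) ?_
  refine (hi.dense.open_subset_closure_inter ho).trans ?_
  -- By density every point of `o` is a limit of points of `o ∩ range i`, and these lie in the
  -- closed set `i '' K`.
  have h1 : o ∩ Set.range i ⊆ i '' K := by
    rintro _ ⟨hy, z, rfl⟩
    exact ⟨z, htK (hot hy), rfl⟩
  have h2 : IsClosed (i '' K) := (hK.image hi.toIsDenseInducing.continuous).isClosed
  exact (closure_minimal h1 h2).trans (Set.image_subset_range i K)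

/-- A locally compact, second countable Hausdorff space is Polish. -/
theorem PolishSpace.of_locallyCompactSpace [T2Space X] [LocallyCompactSpace X]
    [SecondCountableTopology X] : PolishSpace X := by
  let _ := TopologicalSpace.metrizableSpaceMetric X
  have hi : IsDenseEmbedding ((↑) : X → UniformSpace.Completion X) :=
    UniformSpace.Completion.isDenseEmbedding_coe
  have h1 : PolishSpace (Set.range ((↑) : X → UniformSpace.Completion X)) :=
    hi.isOpen_range_of_locallyCompactSpace.polishSpace
  exact hi.isEmbedding.toHomeomorph.isClosedEmbedding.polishSpace

theorem ContinuousMap.isCompletelyMetrizableSpace_of_locallyCompactSpace [T2Space X]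
    [LocallyCompactSpace X] [SecondCountableTopology X] :
    TopologicalSpace.IsCompletelyMetrizableSpace C(X, X) := by
  have := PolishSpace.of_locallyCompactSpace (X := X)
  let _ := TopologicalSpace.upgradeIsCompletelyMetrizable X
  infer_instance

end Polish

/-! ### Lie series of a holomorphic vector field -/

section LieSeries

variable {E : Type*} [NormedAddCommGroup E] [NormedSpace ℂ E]

/-- The iterated Lie derivatives of the identity along the vector field `V`: the `k`-th derivative
of an integral curve `c` of `V` is `lieIterate V k ∘ c`. -/
noncomputable def lieIterate (V : E → E) : ℕ → E → E
  | 0 => id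
  | k + 1 => fun y => fderiv ℂ (lieIterate V k) y (V y)

theorem analyticOnNhd_lieIterate [CompleteSpace E] {V : E → E} {U : Set E}
    (hV : AnalyticOnNhd ℂ V U) (k : ℕ) : AnalyticOnNhd ℂ (lieIterate V k) U := by
  induction k with
  | zero => exact analyticOnNhd_id
  | succ k ih =>
    exact fun y hy => AnalyticAt.comp₂
      (h := fun p : (E →L[ℂ] E) × E => p.1 p.2)
      ((ContinuousLinearMap.id ℂ (E →L[ℂ] E)).analyticAt_bilinear _) (ih.fderiv y hy) (hV y hy)

theorem iteratedDeriv_eq_lieIterate [CompleteSpace E] {V : E → E} {U : Set E}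
    (hV : AnalyticOnNhd ℂ V U) {c : ℂ → E} {D : Set ℂ} (hD : IsOpen D)
    (hc : ∀ t ∈ D, c t ∈ U ∧ HasDerivAt c (V (c t)) t) (k : ℕ) :
    ∀ t ∈ D, iteratedDeriv k c t = lieIterate V k (c t) := by
  induction k with
  | zero => simp [lieIterate]
  | succ k ih =>
    intro t ht
    have h1 : iteratedDeriv k c =ᶠ[𝓝 t] fun s => lieIterate V k (c s) :=
      Filter.eventually_of_mem (hD.mem_nhds ht) ih
    rw [iteratedDeriv_succ, h1.deriv_eq]
    exact ((analyticOnNhd_lieIterate hV k _ (hc t ht).1).differentiableAt.hasFDerivAt.comp_hasDerivAt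
      t (hc t ht).2).deriv

/-- This is the Taylor series of `c` at `0`. Its coefficients depend only on `c 0`, which gives both
uniqueness of integral curves and holomorphic dependence on the starting point. -/
theorem hasSum_lieIterate [CompleteSpace E] {V : E → E} {U : Set E}
    (hV : AnalyticOnNhd ℂ V U) {c : ℂ → E} {r : ℝ}
    (hc : ∀ t ∈ Metric.ball (0 : ℂ) r, c t ∈ U ∧ HasDerivAt c (V (c t)) t) {t : ℂ}
    (ht : t ∈ Metric.ball (0 : ℂ) r) :
    HasSum (fun k : ℕ => (k.factorial : ℂ)⁻¹ • t ^ k • lieIterate V k (c 0)) (c t) := by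
  have h1 : DifferentiableOn ℂ c (Metric.ball 0 r) := fun s hs =>
    (hc s hs).2.differentiableAt.differentiableWithinAt
  have h2 := Complex.hasSum_taylorSeries_on_ball h1 ht
  have h0 : (0 : ℂ) ∈ Metric.ball (0 : ℂ) r :=
    Metric.mem_ball_self (dist_nonneg.trans_lt (Metric.mem_ball.1 ht))
  simpa [iteratedDeriv_eq_lieIterate hV Metric.isOpen_ball hc _ 0 h0] using h2

/-- A bounded family of integral curves of a holomorphic vector field depends holomorphically on
the starting point. -/
theorem analyticOnNhd_of_integralCurves [FiniteDimensional ℂ E] {V : E → E} {U N : Set E}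
    (hV : AnalyticOnNhd ℂ V U) (hN : IsOpen N) {r M : ℝ} (hr : 0 < r) {Φ : ℂ → E → E}
    (h0 : ∀ y ∈ N, Φ 0 y = y)
    (hΦ : ∀ y ∈ N, ∀ t ∈ Metric.ball (0 : ℂ) r,
      Φ t y ∈ U ∧ HasDerivAt (fun s => Φ s y) (V (Φ t y)) t)
    (hM : ∀ y ∈ N, ∀ t ∈ Metric.ball (0 : ℂ) r, ‖Φ t y‖ ≤ M) :
    AnalyticOnNhd ℂ (Function.uncurry Φ) (Metric.ball (0 : ℂ) (r / 4) ×ˢ N) := by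
  have : CompleteSpace E := FiniteDimensional.complete ℂ E
  have hr0 : (0 : ℂ) ∈ Metric.ball (0 : ℂ) r := Metric.mem_ball_self hr
  -- Cauchy's estimate on the circle of radius `r / 2` for each single curve; no regularity of `Φ`
  -- in `y` enters. For `‖t‖ ≤ r / 4` the `k`-th term of the series is then at most `M / 2 ^ k`.
  have hbound : ∀ k : ℕ, ∀ y ∈ N, ‖lieIterate V k y‖ ≤ k.factorial * M / (r / 2) ^ k := by
    intro k y hy
    have h1 := iteratedDeriv_eq_lieIterate hV Metric.isOpen_ball (hΦ y hy) k 0 hr0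
    rw [h0 y hy] at h1
    rw [← h1]
    refine Complex.norm_iteratedDeriv_le_of_forall_mem_sphere_norm_le k (by positivity) ?_ ?_
    · refine DifferentiableOn.diffContOnCl_ball (U := Metric.ball 0 r) (fun t ht => ?_) ?_
      · exact (hΦ y hy t ht).2.differentiableAt.differentiableWithinAt
      · exact Metric.closedBall_subset_ball (by linarith)
    · intro t ht
      exact hM y hy t (Metric.sphere_subset_ball (by linarith) ht)
  have hUN : N ⊆ U := fun y hy => h0 y hy ▸ (hΦ y hy 0 hr0).1
  have hunif : TendstoUniformlyOn
      (fun K : ℕ => fun p : ℂ × E => ∑ k ∈ Finset.range K,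
        (k.factorial : ℂ)⁻¹ • p.1 ^ k • lieIterate V k p.2)
      (fun p => ∑' k : ℕ, (k.factorial : ℂ)⁻¹ • p.1 ^ k • lieIterate V k p.2) Filter.atTop
      (Metric.ball (0 : ℂ) (r / 4) ×ˢ N) := by
    refine tendstoUniformlyOn_tsum_nat (u := fun k => M * (1 / 2) ^ k)
      (summable_geometric_two.mul_left M) ?_
    rintro k ⟨t, y⟩ ⟨ht, hy⟩
    have ht' : ‖t‖ ≤ r / 4 := by simpa using (Metric.mem_ball.1 ht).le
    have hM0 : 0 ≤ M := (norm_nonneg _).trans (hM y hy 0 hr0)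
    rw [norm_smul, norm_smul, norm_inv, norm_pow, Complex.norm_natCast]
    calc (k.factorial : ℝ)⁻¹ * (‖t‖ ^ k * ‖lieIterate V k y‖)
        ≤ (k.factorial : ℝ)⁻¹ * ((r / 4) ^ k * (k.factorial * M / (r / 2) ^ k)) := by
          gcongr
          exact hbound k y hy
      _ = M * ((r / 4) ^ k / (r / 2) ^ k) := by
          have : (k.factorial : ℝ) ≠ 0 := by positivity
          field_simp
      _ = M * (1 / 2) ^ k := by
          rw [← div_pow]
          congr 2
          field_simp
          norm_num
  refine (hunif.tendstoLocallyUniformlyOn.analyticOnNhd_of_finiteDimensional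
    (Metric.isOpen_ball.prod hN) (Filter.Eventually.of_forall fun K => ?_)).congr
    (Metric.isOpen_ball.prod hN) ?_
  · refine DifferentiableOn.fun_sum fun k _ => DifferentiableOn.const_smul ?_ _
    refine DifferentiableOn.smul (by fun_prop) ?_
    exact (analyticOnNhd_lieIterate hV k).differentiableOn.comp differentiableOn_snd
      fun p hp => hUN hp.2
  · rintro ⟨t, y⟩ ⟨ht, hy⟩
    have h2 := hasSum_lieIterate hV (hΦ y hy) (Metric.ball_subset_ball (by linarith) ht)
    rw [h0 y hy] at h2
    exact h2.tsum_eq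

end LieSeries

/-! ### Vector fields and integral curves in a chart -/

section CoordinateField

variable {E : Type*} [NormedAddCommGroup E] [NormedSpace ℂ E]
  {X : Type*} [TopologicalSpace X] [ChartedSpace E X]

/-- The coordinate expression of the vector field `v` in the preferred chart at `q`. -/
noncomputable def coordField (q : X) (v : (x : X) → TangentSpace 𝓘(ℂ, E) x) (y : E) : E :=
  mfderiv 𝓘(ℂ, E) 𝓘(ℂ, E) (extChartAt 𝓘(ℂ, E) q) ((extChartAt 𝓘(ℂ, E) q).symm y)
    (v ((extChartAt 𝓘(ℂ, E) q).symm y))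

variable [IsManifold 𝓘(ℂ, E) ω X]

theorem IsHolomorphicVectorField.analyticOnNhd_coordField [CompleteSpace E]
    {v : (x : X) → TangentSpace 𝓘(ℂ, E) x}
    (hv : IsHolomorphicVectorField v) (q : X) :
    AnalyticOnNhd ℂ (coordField q v) (extChartAt 𝓘(ℂ, E) q).target := by
  intro y hy
  have hsrc : (extChartAt 𝓘(ℂ, E) q).symm y ∈ (extChartAt 𝓘(ℂ, E) q).source :=
    (extChartAt 𝓘(ℂ, E) q).map_target hy
  rw [extChartAt_source] at hsrc
  have h1 := ((trivializationAt E (TangentSpace 𝓘(ℂ, E)) q).contMDiffAt_section_iff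
    (n := ω) (IB := 𝓘(ℂ, E)) hsrc).1 (hv _)
  have h2 : ContMDiffAt 𝓘(ℂ, E) 𝓘(ℂ, E) ω (extChartAt 𝓘(ℂ, E) q).symm y :=
    (contMDiffOn_extChartAt_symm q).contMDiffAt
      ((isOpen_extChartAt_target q).mem_nhds hy)
  refine (((h1.comp y h2).contDiffAt).congr_of_eventuallyEq ?_).analyticAt
  filter_upwards [(isOpen_extChartAt_target q).mem_nhds hy] with z hz
  have hz' : (extChartAt 𝓘(ℂ, E) q).symm z ∈ (chartAt E q).source := by
    rw [← extChartAt_source 𝓘(ℂ, E)]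
    exact (extChartAt 𝓘(ℂ, E) q).map_target hz
  refine (DFunLike.congr_fun (TangentBundle.continuousLinearMapAt_trivializationAt hz')
    (v ((extChartAt 𝓘(ℂ, E) q).symm z))).symm.trans ?_
  exact congrFun (Bundle.Trivialization.coe_linearMapAt_of_mem (R := ℂ) _ hz') _

omit [IsManifold 𝓘(ℂ, E) ω X] in
theorem coordField_extChartAt (v : (x : X) → TangentSpace 𝓘(ℂ, E) x) {q x : X}
    (hx : x ∈ (extChartAt 𝓘(ℂ, E) q).source) :
    coordField q v (extChartAt 𝓘(ℂ, E) q x) =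
      mfderiv 𝓘(ℂ, E) 𝓘(ℂ, E) (extChartAt 𝓘(ℂ, E) q) x (v x) := by
  -- The type of `v x'` depends on the point, so the point is generalised before substituting.
  have h : ∀ x', x' = x → (mfderiv 𝓘(ℂ, E) 𝓘(ℂ, E) (extChartAt 𝓘(ℂ, E) q) x' (v x') : E) =
      mfderiv 𝓘(ℂ, E) 𝓘(ℂ, E) (extChartAt 𝓘(ℂ, E) q) x (v x) := by
    rintro _ rfl
    rfl
  exact h _ ((extChartAt 𝓘(ℂ, E) q).left_inv hx)

theorem IsEntireIntegralCurve.hasDerivAt_extChartAt {v : (x : X) → TangentSpace 𝓘(ℂ, E) x}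
    {γ : ℂ → X} (hγ : IsEntireIntegralCurve γ v) {q : X} {t : ℂ}
    (ht : γ t ∈ (extChartAt 𝓘(ℂ, E) q).source) :
    HasDerivAt (fun s => extChartAt 𝓘(ℂ, E) q (γ s))
      (coordField q v (extChartAt 𝓘(ℂ, E) q (γ t))) t := by
  have h1 : HasMFDerivAt 𝓘(ℂ, E) 𝓘(ℂ, E) (extChartAt 𝓘(ℂ, E) q) (γ t)
      (mfderiv 𝓘(ℂ, E) 𝓘(ℂ, E) (extChartAt 𝓘(ℂ, E) q) (γ t)) :=
    (mdifferentiableAt_extChartAt (by rwa [extChartAt_source] at ht)).hasMFDerivAt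
  have h2 := (h1.comp t (hγ t)).hasFDerivAt
  rw [hasDerivAt_iff_hasFDerivAt]
  refine h2.congr_fderiv ?_
  rw [coordField_extChartAt v ht]
  apply ContinuousLinearMap.ext_ring
  refine (congrArg (mfderiv 𝓘(ℂ, E) 𝓘(ℂ, E) (extChartAt 𝓘(ℂ, E) q) (γ t))
    (one_smul ℂ (v (γ t)))).trans ?_
  exact (one_smul ℂ (_ : E)).symm

omit [IsManifold 𝓘(ℂ, E) ω X] in
theorem IsEntireIntegralCurve.continuous {v : (x : X) → TangentSpace 𝓘(ℂ, E) x}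
    {γ : ℂ → X} (hγ : IsEntireIntegralCurve γ v) : Continuous γ :=
  continuous_iff_continuousAt.2 fun t => (hγ t).continuousAt

end CoordinateField

/-! ### The flow of a complete field and its joint holomorphy -/

section Flow

variable {E : Type*} [NormedAddCommGroup E] [NormedSpace ℂ E]
  {X : Type*} [TopologicalSpace X] [ChartedSpace E X]
  {v : (x : X) → TangentSpace 𝓘(ℂ, E) x}

theorem IsEntireIntegralCurve.comp_add {γ : ℂ → X} (hγ : IsEntireIntegralCurve γ v) (a : ℂ) :
    IsEntireIntegralCurve (fun t => γ (t + a)) v := by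
  intro t
  have h1 : HasMFDerivAt 𝓘(ℂ, ℂ) 𝓘(ℂ, ℂ) (fun t : ℂ => t + a) t (ContinuousLinearMap.id ℂ ℂ) :=
    ((hasFDerivAt_id t).add_const a).hasMFDerivAt
  exact (hγ (t + a)).comp t h1

variable [IsManifold 𝓘(ℂ, E) ω X]

/-- Integral curves starting near `q` remain in the chart at `q` for a time which is uniform in
the starting point. -/
theorem IsHolomorphicVectorField.exists_trapping [FiniteDimensional ℂ E] [T2Space X]
    (hv : IsHolomorphicVectorField v) (q : X) :
    ∃ ρ > 0, ∃ r > 0, Metric.closedBall (extChartAt 𝓘(ℂ, E) q q) (2 * ρ) ⊆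
        (extChartAt 𝓘(ℂ, E) q).target ∧
      ∀ γ : ℂ → X, IsEntireIntegralCurve γ v → γ 0 ∈ (extChartAt 𝓘(ℂ, E) q).source →
      extChartAt 𝓘(ℂ, E) q (γ 0) ∈ Metric.ball (extChartAt 𝓘(ℂ, E) q q) ρ →
      ∀ t ∈ Metric.ball (0 : ℂ) r, γ t ∈ (extChartAt 𝓘(ℂ, E) q).source ∧
        extChartAt 𝓘(ℂ, E) q (γ t) ∈ Metric.closedBall (extChartAt 𝓘(ℂ, E) q q) (2 * ρ) := by
  have : CompleteSpace E := FiniteDimensional.complete ℂ E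
  have : ProperSpace E := FiniteDimensional.proper ℂ E
  set e := extChartAt 𝓘(ℂ, E) q with he
  obtain ⟨R, hR, hball⟩ := Metric.nhds_basis_closedBall.mem_iff.1
    ((isOpen_extChartAt_target (I := 𝓘(ℂ, E)) q).mem_nhds (mem_extChartAt_target q))
  obtain ⟨M, hM⟩ := (isCompact_closedBall (e q) R).exists_bound_of_continuousOn
    ((hv.analyticOnNhd_coordField q).continuousOn.mono hball)
  have hM0 : 0 ≤ M := (norm_nonneg _).trans (hM _ (Metric.mem_closedBall_self hR.le))
  obtain ⟨ρ, rfl⟩ : ∃ ρ, R = 2 * ρ := ⟨R / 2, by ring⟩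
  have hρ : 0 < ρ := by linarith
  -- The coordinate speed is at most `M`, so within this time a curve moves by less than `ρ`; the `+
  -- 1` covers `M = 0`.
  refine ⟨ρ, hρ, ρ / (M + 1), by positivity, hball, ?_⟩
  intro γ hγ h0 h0ρ t ht
  have htM : M * ‖t‖ < ρ := by
    have h1 : ‖t‖ < ρ / (M + 1) := by simpa using ht
    rw [lt_div_iff₀ (by positivity)] at h1
    nlinarith [norm_nonneg t]
  set C : Set X := e.symm '' Metric.closedBall (e q) (2 * ρ) with hC
  have hCc : IsClosed C := ((isCompact_closedBall _ _).image_of_continuousOn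
    ((continuousOn_extChartAt_symm q).mono hball)).isClosed
  have hCsrc : ∀ x ∈ C, x ∈ e.source ∧ e x ∈ Metric.closedBall (e q) (2 * ρ) := by
    rintro _ ⟨y, hy, rfl⟩
    exact ⟨e.map_target (hball hy), by rwa [e.right_inv (hball hy)]⟩
  have hCmem : ∀ x ∈ e.source, e x ∈ Metric.closedBall (e q) (2 * ρ) → x ∈ C := fun x hx hx' =>
    ⟨e x, hx', e.left_inv hx⟩
  have hpath : Continuous fun s : ℝ => γ (s * t) :=
    hγ.continuous.comp (by fun_prop)
  -- Continuous induction along the segment from `0` to `t`. Membership in `C` is recorded because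
  -- the chart is meaningless outside its source; `C` is compact, hence closed in `X`, so the curve
  -- cannot leave the chart in the limit.
  let S : Set ℝ := {s | s ∈ {s : ℝ | γ (s * t) ∈ C} ∧
    ‖e (γ (s * t)) - e (γ 0)‖ ≤ M * ‖t‖ * s}
  have hS : IsClosed S := by
    refine IsClosed.isClosed_le (hCc.preimage hpath) ?_ (by fun_prop)
    refine ContinuousOn.norm (ContinuousOn.sub ?_ continuousOn_const)
    exact (continuousOn_extChartAt q).comp hpath.continuousOn fun s hs => (hCsrc _ hs).1
  have hsub : Set.Icc (0 : ℝ) 1 ⊆ S := by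
    refine IsClosed.Icc_subset_of_forall_mem_nhdsWithin (hS.inter isClosed_Icc) ?_ ?_
    · refine ⟨?_, by simp⟩
      simpa using hCmem _ h0 (Metric.ball_subset_closedBall.trans
        (Metric.closedBall_subset_closedBall (by linarith)) h0ρ)
    · rintro s ⟨⟨hs1, hs2⟩, hs3⟩
      have hsb : e (γ (s * t)) ∈ Metric.ball (e q) (2 * ρ) := by
        rw [Metric.mem_ball, dist_eq_norm] at h0ρ ⊢
        have h1 : M * ‖t‖ * s ≤ M * ‖t‖ :=
          mul_le_of_le_one_right (mul_nonneg hM0 (norm_nonneg t)) hs3.2.le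
        have h2 : e (γ (s * t)) - e q = (e (γ (s * t)) - e (γ 0)) + (e (γ 0) - e q) := by abel
        rw [h2]
        linarith [norm_add_le (e (γ (s * t)) - e (γ 0)) (e (γ 0) - e q)]
      have hev : ∀ᶠ s' : ℝ in 𝓝 s, γ (s' * t) ∈ e.source ∧
          e (γ (s' * t)) ∈ Metric.ball (e q) (2 * ρ) := by
        have h1 := hpath.continuousAt (x := s)
        refine (h1.eventually_mem ((isOpen_extChartAt_source q).mem_nhds (hCsrc _ hs1).1)).and ?_
        exact (ContinuousAt.comp (f := fun s : ℝ => γ (s * t)) (g := e)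
          (continuousAt_extChartAt' (hCsrc _ hs1).1) h1).eventually
          (Metric.isOpen_ball.mem_nhds hsb)
      obtain ⟨δ, hδ, hδball⟩ := Metric.eventually_nhds_iff_ball.1 hev
      have hIoo : Set.Ioo s (s + δ) ∈ 𝓝[>] s := Ioo_mem_nhdsGT (by linarith)
      filter_upwards [hIoo] with s' hs'
      have hin : ∀ u ∈ Set.Icc s s', γ (u * t) ∈ e.source ∧
          e (γ (u * t)) ∈ Metric.ball (e q) (2 * ρ) := fun u hu => hδball u (by
        rw [Metric.mem_ball, Real.dist_eq, abs_lt]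
        constructor <;> linarith [hu.1, hu.2, hs'.2])
      have hderiv : ∀ u ∈ Set.Icc s s', HasDerivWithinAt (fun u : ℝ => e (γ (u * t)))
          (t • coordField q v (e (γ (u * t)))) (Set.Icc s s') u := by
        intro u hu
        have h1 := hγ.hasDerivAt_extChartAt (hin u hu).1
        have h2 : HasDerivAt (fun u : ℝ => (u : ℂ) * t) t u := by
          simpa using (Complex.ofRealCLM.hasDerivAt (x := u)).mul_const t
        exact (HasDerivAt.scomp u h1 h2).hasDerivWithinAt
      have hmv := (convex_Icc s s').norm_image_sub_le_of_norm_hasDerivWithin_le hderiv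
        (C := ‖t‖ * M) (fun u hu => by
          rw [norm_smul]
          exact mul_le_mul_of_nonneg_left
            (hM _ (Metric.ball_subset_closedBall (hin u hu).2)) (norm_nonneg _))
        (Set.left_mem_Icc.2 hs'.1.le) (Set.right_mem_Icc.2 hs'.1.le)
      have hlast := hin s' (Set.right_mem_Icc.2 hs'.1.le)
      refine ⟨hCmem _ hlast.1 (Metric.ball_subset_closedBall hlast.2), ?_⟩
      rw [Real.norm_of_nonneg (by linarith [hs'.1])] at hmv
      have h2 : e (γ (s' * t)) - e (γ 0) =
        (e (γ (s' * t)) - e (γ (s * t))) + (e (γ (s * t)) - e (γ 0)) := by abel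
      rw [h2]
      refine (norm_add_le _ _).trans ((add_le_add hmv hs2).trans (le_of_eq (by ring)))
  have h1 := (hsub (Set.right_mem_Icc.2 zero_le_one)).1
  simpa using hCsrc _ h1

/-- The times of agreement form a clopen subset of `ℂ`: near such a time both curves stay in one
chart and are the sum of the same Lie series. -/
theorem IsEntireIntegralCurve.eq_of_apply_zero_eq [FiniteDimensional ℂ E] [T2Space X]
    (hv : IsHolomorphicVectorField v) {γ₁ γ₂ : ℂ → X} (h₁ : IsEntireIntegralCurve γ₁ v)
    (h₂ : IsEntireIntegralCurve γ₂ v) (h : γ₁ 0 = γ₂ 0) : γ₁ = γ₂ := by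
  have : CompleteSpace E := FiniteDimensional.complete ℂ E
  have hclopen : IsClopen {t | γ₁ t = γ₂ t} := by
    refine ⟨isClosed_eq h₁.continuous h₂.continuous, isOpen_iff_mem_nhds.2 fun a ha => ?_⟩
    obtain ⟨ρ, hρ, r, hr, hball, htrap⟩ := hv.exists_trapping (γ₁ a)
    set e := extChartAt 𝓘(ℂ, E) (γ₁ a) with he
    have hsum : ∀ γ : ℂ → X, IsEntireIntegralCurve γ v → γ a = γ₁ a →
        ∀ t ∈ Metric.ball (0 : ℂ) r, γ (t + a) ∈ e.source ∧
        HasSum (fun k : ℕ => (k.factorial : ℂ)⁻¹ • t ^ k •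
          lieIterate (coordField (γ₁ a) v) k (e (γ₁ a))) (e (γ (t + a))) := by
      intro γ hγ hγa t ht
      have h1 := htrap _ (hγ.comp_add a) (by simp [hγa, he])
        (by simpa [hγa] using hρ)
      refine ⟨(h1 t ht).1, ?_⟩
      have h2 := hasSum_lieIterate (hv.analyticOnNhd_coordField (γ₁ a))
        (c := fun s => e (γ (s + a))) (fun s hs => ⟨hball (h1 s hs).2,
          (hγ.comp_add a).hasDerivAt_extChartAt (h1 s hs).1⟩) ht
      simpa [hγa] using h2
    filter_upwards [Metric.ball_mem_nhds a hr] with s hs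
    have hs' : s - a ∈ Metric.ball (0 : ℂ) r := by simpa [dist_eq_norm] using hs
    have h3 := hsum γ₁ h₁ rfl _ hs'
    have h4 := hsum γ₂ h₂ ha.symm _ hs'
    rw [sub_add_cancel] at h3 h4
    exact e.injOn h3.1 h4.1 (h3.2.unique h4.2)
  have huniv := hclopen.eq_univ ⟨0, h⟩
  funext t
  exact (huniv ▸ Set.mem_univ t : t ∈ {t | γ₁ t = γ₂ t})

/-- The flow of a complete vector field. -/
noncomputable def IsCompleteVectorField.flow (hc : IsCompleteVectorField v) (t : ℂ) (x : X) : X :=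
  (hc x).choose t

omit [IsManifold 𝓘(ℂ, E) ω X] in
theorem IsCompleteVectorField.flow_zero (hc : IsCompleteVectorField v) (x : X) :
    hc.flow 0 x = x := (hc x).choose_spec.1

omit [IsManifold 𝓘(ℂ, E) ω X] in
theorem IsCompleteVectorField.isEntireIntegralCurve_flow (hc : IsCompleteVectorField v) (x : X) :
    IsEntireIntegralCurve (fun t => hc.flow t x) v := (hc x).choose_spec.2

/-- The curves in `flow` are chosen separately for each point, so the group law rests on uniqueness.
-/
theorem IsCompleteVectorField.flow_add [FiniteDimensional ℂ E] [T2Space X]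
    (hc : IsCompleteVectorField v) (hv : IsHolomorphicVectorField v) (s t : ℂ) (x : X) :
    hc.flow (s + t) x = hc.flow s (hc.flow t x) :=
  congrFun (((hc.isEntireIntegralCurve_flow x).comp_add t).eq_of_apply_zero_eq hv
    (hc.isEntireIntegralCurve_flow (hc.flow t x)) (by simp [hc.flow_zero])) s

/-- Trapping gives a disc of times common to all starting points near `q`, on which the Lie series
in the chart applies. -/
theorem IsCompleteVectorField.contMDiffAt_flow_zero [FiniteDimensional ℂ E] [T2Space X]
    (hc : IsCompleteVectorField v) (hv : IsHolomorphicVectorField v) (q : X) :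
    ContMDiffAt (𝓘(ℂ, ℂ).prod 𝓘(ℂ, E)) 𝓘(ℂ, E) ω (Function.uncurry hc.flow) (0, q) := by
  have : CompleteSpace E := FiniteDimensional.complete ℂ E
  obtain ⟨ρ, hρ, r, hr, hball, htrap⟩ := hv.exists_trapping q
  set e := extChartAt 𝓘(ℂ, E) q with he
  let N := Metric.ball (e q) ρ
  have hNt : N ⊆ e.target := Metric.ball_subset_closedBall.trans
    ((Metric.closedBall_subset_closedBall (by linarith)).trans hball)
  have hstart : ∀ y ∈ N, ∀ t ∈ Metric.ball (0 : ℂ) r,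
      hc.flow t (e.symm y) ∈ e.source ∧
      e (hc.flow t (e.symm y)) ∈ Metric.closedBall (e q) (2 * ρ) := fun y hy =>
    htrap _ (hc.isEntireIntegralCurve_flow (e.symm y))
      (by simpa [hc.flow_zero] using e.map_target (hNt hy))
      (by rw [hc.flow_zero, e.right_inv (hNt hy)]; exact hy)
  have hΦ := analyticOnNhd_of_integralCurves (Φ := fun t y => e (hc.flow t (e.symm y)))
    (hv.analyticOnNhd_coordField q) (N := N) Metric.isOpen_ball (M := ‖e q‖ + 2 * ρ) hr
    (fun y hy => by simp [hc.flow_zero, e.right_inv (hNt hy)])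
    (fun y hy t ht => ⟨hball (hstart y hy t ht).2,
      (hc.isEntireIntegralCurve_flow _).hasDerivAt_extChartAt (hstart y hy t ht).1⟩)
    (fun y hy t ht => by
      have h1 := (hstart y hy t ht).2
      rw [Metric.mem_closedBall, dist_eq_norm] at h1
      have h2 := norm_add_le (e (hc.flow t (e.symm y)) - e q) (e q)
      rw [sub_add_cancel] at h2
      linarith)
  have hΦ0 : ContMDiffAt 𝓘(ℂ, ℂ × E) 𝓘(ℂ, E) ω
      (Function.uncurry fun t y => e (hc.flow t (e.symm y))) (0, e q) :=
    (hΦ (0, e q) ⟨Metric.mem_ball_self (by positivity),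
      Metric.mem_ball_self hρ⟩).contDiffAt.contMDiffAt
  have hpair : ContMDiffAt (𝓘(ℂ, ℂ).prod 𝓘(ℂ, E)) 𝓘(ℂ, ℂ × E) ω
      (fun p : ℂ × X => (p.1, e p.2)) (0, q) :=
    contMDiffAt_fst.prodMk_space
      ((contMDiffAt_extChartAt (I := 𝓘(ℂ, E)) (x := q)).comp (0, q) contMDiffAt_snd)
  have hsymm : ContMDiffAt 𝓘(ℂ, E) 𝓘(ℂ, E) ω e.symm (e q) :=
    (contMDiffOn_extChartAt_symm q).contMDiffAt
      ((isOpen_extChartAt_target q).mem_nhds (mem_extChartAt_target q))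
  have h1 := hΦ0.comp (0, q) (f := fun p : ℂ × X => (p.1, e p.2)) hpair
  have h2 := ContMDiffAt.comp (0, q) (g := e.symm) (by
    simpa [hc.flow_zero, he] using hsymm) h1
  refine h2.congr_of_eventuallyEq ?_
  have hN : ∀ᶠ x in 𝓝 q, x ∈ e.source ∧ e x ∈ N :=
    Filter.Eventually.and ((isOpen_extChartAt_source q).mem_nhds (mem_extChartAt_source q))
      ((continuousAt_extChartAt q).eventually (Metric.ball_mem_nhds _ hρ))
  have hT : ∀ᶠ t in 𝓝 (0 : ℂ), t ∈ Metric.ball (0 : ℂ) r := Metric.ball_mem_nhds _ hr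
  rw [nhds_prod_eq]
  filter_upwards [hT.prod_mk hN] with p hp
  have h3 := (hstart _ hp.2.2 _ hp.1).1
  rw [e.left_inv hp.2.1] at h3
  simp [Function.uncurry, e.left_inv hp.2.1, e.left_inv h3]

/-- The flow of a complete holomorphic vector field is jointly holomorphic. -/
theorem IsCompleteVectorField.contMDiff_flow [FiniteDimensional ℂ E] [T2Space X]
    (hc : IsCompleteVectorField v) (hv : IsHolomorphicVectorField v) :
    ContMDiff (𝓘(ℂ, ℂ).prod 𝓘(ℂ, E)) 𝓘(ℂ, E) ω (Function.uncurry hc.flow) := by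
  have : CompleteSpace E := FiniteDimensional.complete ℂ E
  suffices H : ∀ x : X, {t : ℂ | ContMDiffAt (𝓘(ℂ, ℂ).prod 𝓘(ℂ, E)) 𝓘(ℂ, E) ω
      (Function.uncurry hc.flow) (t, x)} = Set.univ by
    rintro ⟨t, x⟩
    exact (H x ▸ Set.mem_univ t : t ∈ {t : ℂ | _})
  intro x
  refine IsClopen.eq_univ ⟨?_, ?_⟩ ⟨0, hc.contMDiffAt_flow_zero hv x⟩
  · refine isClosed_of_closure_subset fun a ha => ?_
    have h1 : ∀ᶠ p in 𝓝 ((0 : ℂ), hc.flow a x), ContMDiffAt (𝓘(ℂ, ℂ).prod 𝓘(ℂ, E)) 𝓘(ℂ, E) ω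
      (Function.uncurry hc.flow) p := 
      (contMDiffAt_iff_contMDiffAt_nhds (by simp)).1 (hc.contMDiffAt_flow_zero hv (hc.flow a x))
    -- For a good time `t` close to `a`, the flow at time `s` is the time-`(s - t)` flow after the
    -- time-`t` flow. The latter is holomorphic at `x`, and `(a - t, hc.flow t x)` is so near `(0,
    -- hc.flow a x)` that the former is holomorphic there.
    have h2 : Filter.Tendsto (fun t : ℂ => (a - t, hc.flow t x)) (𝓝 a)
        (𝓝 ((0 : ℂ), hc.flow a x)) := by
      have h3 : Continuous fun t : ℂ => (a - t, hc.flow t x) :=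
        (continuous_const.sub continuous_id).prodMk (hc.isEntireIntegralCurve_flow x).continuous
      simpa using h3.tendsto a
    obtain ⟨t, ht1, ht2⟩ := (mem_closure_iff_frequently.1 ha).and_eventually
      (h2.eventually h1) |>.exists
    have h4 : ContMDiffAt 𝓘(ℂ, E) 𝓘(ℂ, E) ω (hc.flow t) x :=
      ContMDiffAt.comp x (f := fun y : X => (t, y)) ht1
        (contMDiffAt_const.prodMk contMDiffAt_id)
    have h5 : ContMDiffAt (𝓘(ℂ, ℂ).prod 𝓘(ℂ, E)) (𝓘(ℂ, ℂ).prod 𝓘(ℂ, E)) ω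
        (fun p : ℂ × X => (p.1 - t, hc.flow t p.2)) (a, x) :=
      ContMDiffAt.prodMk (contMDiffAt_fst.sub contMDiffAt_const)
        (ContMDiffAt.comp (a, x) h4 contMDiffAt_snd)
    refine (ContMDiffAt.comp (a, x) ht2 h5).congr_of_eventuallyEq
      (Filter.Eventually.of_forall fun p => ?_)
    simp [Function.uncurry, ← hc.flow_add hv]
  · refine isOpen_iff_mem_nhds.2 fun a ha => ?_
    have h1 := (contMDiffAt_iff_contMDiffAt_nhds (by simp)).1 ha
    have h2 : Continuous fun t : ℂ => (t, x) := by fun_prop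
    exact (h2.tendsto a).eventually h1

end Flow

/-! ### Pulling back complete fields by automorphisms -/

section Pullback

variable {E : Type*} [NormedAddCommGroup E] [NormedSpace ℂ E]
  {X : Type*} [TopologicalSpace X] [ChartedSpace E X] [IsManifold 𝓘(ℂ, E) ω X]
  {v : (x : X) → TangentSpace 𝓘(ℂ, E) x} {f g : X → X}

omit [IsManifold 𝓘(ℂ, E) ω X] in
theorem mfderiv_comp_mfderiv_of_leftInverse (hf : ContMDiff 𝓘(ℂ, E) 𝓘(ℂ, E) ω f)
    (hg : ContMDiff 𝓘(ℂ, E) 𝓘(ℂ, E) ω g) (hgf : ∀ x, g (f x) = x) (x : X) :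
    (mfderiv 𝓘(ℂ, E) 𝓘(ℂ, E) g (f x) : E →L[ℂ] E) ∘L
      (mfderiv 𝓘(ℂ, E) 𝓘(ℂ, E) f x : E →L[ℂ] E) = ContinuousLinearMap.id ℂ E := by
  have h1 : HasMFDerivAt 𝓘(ℂ, E) 𝓘(ℂ, E) (g ∘ f) x _ :=
    ((hg.mdifferentiable (by simp) (f x)).hasMFDerivAt).comp x
      ((hf.mdifferentiable (by simp) x).hasMFDerivAt)
  have h2 : g ∘ f = id := funext hgf
  rw [h2] at h1
  exact hasMFDerivAt_unique h1 (hasMFDerivAt_id x)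

omit [IsManifold 𝓘(ℂ, E) ω X] in
theorem isInvertible_mfderiv_of_inverse (hf : ContMDiff 𝓘(ℂ, E) 𝓘(ℂ, E) ω f)
    (hg : ContMDiff 𝓘(ℂ, E) 𝓘(ℂ, E) ω g) (hgf : ∀ x, g (f x) = x) (hfg : ∀ x, f (g x) = x)
    (x : X) : (mfderiv 𝓘(ℂ, E) 𝓘(ℂ, E) f x).IsInvertible := by
  refine ContinuousLinearMap.IsInvertible.of_inverse
    (g := (mfderiv 𝓘(ℂ, E) 𝓘(ℂ, E) g (f x) : E →L[ℂ] E)) ?_ ?_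
  · have h1 := mfderiv_comp_mfderiv_of_leftInverse hg hf hfg (f x)
    rw [hgf] at h1
    exact h1
  · exact mfderiv_comp_mfderiv_of_leftInverse hf hg hgf x

theorem IsHolomorphicVectorField.mpullback [CompleteSpace E] (hv : IsHolomorphicVectorField v)
    (hf : ContMDiff 𝓘(ℂ, E) 𝓘(ℂ, E) ω f)
    (hg : ContMDiff 𝓘(ℂ, E) 𝓘(ℂ, E) ω g) (hgf : ∀ x, g (f x) = x) (hfg : ∀ x, f (g x) = x) :
    IsHolomorphicVectorField (VectorField.mpullback 𝓘(ℂ, E) 𝓘(ℂ, E) f v) :=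
  ContMDiff.mpullback_vectorField hv hf (isInvertible_mfderiv_of_inverse hf hg hgf hfg) (by simp)

omit [IsManifold 𝓘(ℂ, E) ω X] in
-- If `γ` is an integral curve of `v`, then `g ∘ γ` is one of the pullback, since the derivative of
-- `g` inverts that of `f`.
theorem IsCompleteVectorField.mpullback (hv : IsCompleteVectorField v)
    (hf : ContMDiff 𝓘(ℂ, E) 𝓘(ℂ, E) ω f)
    (hg : ContMDiff 𝓘(ℂ, E) 𝓘(ℂ, E) ω g) (hgf : ∀ x, g (f x) = x) (hfg : ∀ x, f (g x) = x) :
    IsCompleteVectorField (VectorField.mpullback 𝓘(ℂ, E) 𝓘(ℂ, E) f v) := by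
  intro x
  obtain ⟨γ, h0, hγ⟩ := hv (f x)
  refine ⟨g ∘ γ, by simp [h0, hgf], fun t => ?_⟩
  refine (((hg.mdifferentiable (by simp) (γ t)).hasMFDerivAt).comp t (hγ t)).congr_mfderiv ?_
  have hinv := isInvertible_mfderiv_of_inverse hf hg hgf hfg (g (γ t))
  have key : (mfderiv 𝓘(ℂ, E) 𝓘(ℂ, E) g (γ t) : E →L[ℂ] E) (v (γ t)) =
      VectorField.mpullback 𝓘(ℂ, E) 𝓘(ℂ, E) f v (g (γ t)) := by
    rw [VectorField.mpullback_apply]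
    have h1 : ∀ y, y = γ t → (v y : E) = v (γ t) := by rintro _ rfl; rfl
    have h2 : (mfderiv 𝓘(ℂ, E) 𝓘(ℂ, E) f (g (γ t)) : E →L[ℂ] E)
        ((mfderiv 𝓘(ℂ, E) 𝓘(ℂ, E) g (γ t) : E →L[ℂ] E) (v (γ t))) = v (f (g (γ t))) := by
      rw [h1 _ (hfg (γ t))]
      exact DFunLike.congr_fun (mfderiv_comp_mfderiv_of_leftInverse hg hf hfg (γ t)) (v (γ t))
    obtain ⟨L, hL⟩ := hinv
    rw [← hL, ContinuousLinearMap.inverse_equiv]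
    rw [← hL] at h2
    exact (L.symm_apply_eq.2 h2.symm).symm
  apply ContinuousLinearMap.ext_ring
  refine (congrArg (mfderiv 𝓘(ℂ, E) 𝓘(ℂ, E) g (γ t)) (one_smul ℂ (v (γ t)))).trans ?_
  exact key.trans (one_smul ℂ (_ : E)).symm

omit [IsManifold 𝓘(ℂ, E) ω X] in
theorem span_mpullback_eq_top {ι : Type*} {v : ι → (x : X) → TangentSpace 𝓘(ℂ, E) x}
    (hf : ContMDiff 𝓘(ℂ, E) 𝓘(ℂ, E) ω f)
    (hg : ContMDiff 𝓘(ℂ, E) 𝓘(ℂ, E) ω g) (hgf : ∀ x, g (f x) = x) (hfg : ∀ x, f (g x) = x)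
    {x : X} (hx : Submodule.span ℂ (Set.range fun i => v i (f x)) = ⊤) :
    Submodule.span ℂ (Set.range fun i => VectorField.mpullback 𝓘(ℂ, E) 𝓘(ℂ, E) f (v i) x) = ⊤ := by
  obtain ⟨L, hL⟩ := isInvertible_mfderiv_of_inverse hf hg hgf hfg x
  have h1 : (fun i => VectorField.mpullback 𝓘(ℂ, E) 𝓘(ℂ, E) f (v i) x) =
      L.symm.toLinearEquiv.toLinearMap ∘ fun i => v i (f x) := by
    funext i
    rw [VectorField.mpullback_apply, ← hL, ContinuousLinearMap.inverse_equiv]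
    rfl
  rw [h1, Set.range_comp, Submodule.span_image, hx, Submodule.map_top]
  exact LinearEquiv.range _

end Pullback

/-! ### The Baire space of holomorphic automorphisms -/

section HolomorphicAutomorphisms

variable (E : Type*) [NormedAddCommGroup E] [NormedSpace ℂ E]
  (X : Type*) [TopologicalSpace X] [ChartedSpace E X]

/-- Convergence in the compact-open topology is uniform in charts on a small coordinate ball, and
uniform limits of holomorphic maps are holomorphic. -/
theorem isClosed_setOf_contMDiff [IsManifold 𝓘(ℂ, E) ω X] [FiniteDimensional ℂ E]
    [LocallyCompactSpace X] : IsClosed {f : C(X, X) | ContMDiff 𝓘(ℂ, E) 𝓘(ℂ, E) ω f} := by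
  have : CompleteSpace E := FiniteDimensional.complete ℂ E
  have : ProperSpace E := FiniteDimensional.proper ℂ E
  refine isClosed_of_closure_subset fun f hf x => ?_
  set A := {f : C(X, X) | ContMDiff 𝓘(ℂ, E) 𝓘(ℂ, E) ω f} with hA
  have : (𝓝[A] f).NeBot := mem_closure_iff_nhdsWithin_neBot.1 hf
  set e := extChartAt 𝓘(ℂ, E) x with he
  set e' := extChartAt 𝓘(ℂ, E) (f x) with he'
  have hnear : ∀ᶠ y in 𝓝 (e x), y ∈ e.target ∧ f (e.symm y) ∈ e'.source := by
    refine Filter.Eventually.and ((isOpen_extChartAt_target x).mem_nhds (mem_extChartAt_target x)) ?_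
    have h1 : ContinuousAt (fun y => f (e.symm y)) (e x) :=
      f.continuous.continuousAt.comp (continuousAt_extChartAt_symm x)
    refine h1.eventually_mem ?_
    rw [he, extChartAt_to_inv x]
    exact (isOpen_extChartAt_source (f x)).mem_nhds (mem_extChartAt_source (f x))
  obtain ⟨R, hR, hball⟩ := Metric.nhds_basis_closedBall.mem_iff.1 hnear
  set K : Set E := Metric.closedBall (e x) R
  have hKt : K ⊆ e.target := fun y hy => (hball hy).1
  have hsymm : ContinuousOn e.symm K := (continuousOn_extChartAt_symm x).mono hKt
  have hKc : IsCompact (e.symm '' K) := (isCompact_closedBall _ _).image_of_continuousOn hsymm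
  let s : Set C(X, X) := {h | Set.MapsTo h (e.symm '' K) e'.source}
  have hs : IsOpen s := ContinuousMap.isOpen_setOfPred_mapsTo hKc (isOpen_extChartAt_source (f x))
  have hfs : f ∈ s := by
    rintro _ ⟨y, hy, rfl⟩
    exact (hball hy).2
  let F : C(X, X) → E → E := fun h y => e' (h (e.symm y))
  have hF : ContinuousOn (Function.uncurry F) (s ×ˢ K) := by
    refine (continuousOn_extChartAt (f x)).comp (t := e'.source)
      (f := fun p : C(X, X) × E => p.1 (e.symm p.2)) ?_ ?_
    · exact (continuous_eval (F := C(X, X))).comp_continuousOn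
        (continuousOn_fst.prodMk (hsymm.comp continuousOn_snd fun p hp => hp.2))
    · rintro ⟨h, y⟩ ⟨hh, hy⟩
      exact hh ⟨y, hy, rfl⟩
  have hunif : TendstoUniformlyOn F (F f) (𝓝[A] f) K := by
    intro u hu
    obtain ⟨w, hw, hwu⟩ := (isCompact_closedBall (e x) R).mem_uniformity_of_prod hF hfs
      (symm_le_uniformity hu)
    rw [hs.nhdsWithin_eq hfs] at hw
    filter_upwards [nhdsWithin_le_nhds hw] with h hh y hy
    exact hwu h hh y hy
  have hanalytic : AnalyticOnNhd ℂ (F f) (Metric.ball (e x) R) := by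
    refine (hunif.mono
      Metric.ball_subset_closedBall).tendstoLocallyUniformlyOn.analyticOnNhd_of_finiteDimensional
      Metric.isOpen_ball ?_
    filter_upwards [self_mem_nhdsWithin, nhdsWithin_le_nhds (hs.mem_nhds hfs)] with h hh hhs y hy
    have hyK : y ∈ K := Metric.ball_subset_closedBall hy
    have h1 : ContMDiffAt 𝓘(ℂ, E) 𝓘(ℂ, E) ω e.symm y :=
      (contMDiffOn_extChartAt_symm x).contMDiffAt
        ((isOpen_extChartAt_target x).mem_nhds (hKt hyK))
    have h2 : ContMDiffAt 𝓘(ℂ, E) 𝓘(ℂ, E) ω e' (h (e.symm y)) :=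
      contMDiffAt_extChartAt' (by
        have := hhs ⟨y, hyK, rfl⟩
        rwa [he', extChartAt_source] at this)
    exact ((h2.comp y ((hh _).comp y h1)).contDiffAt.differentiableAt
      (by simp)).differentiableWithinAt
  rw [contMDiffAt_iff]
  refine ⟨f.continuous.continuousAt, ?_⟩
  exact (hanalytic (e x) (Metric.mem_ball_self hR)).contDiffAt.contDiffWithinAt

/-- The pairs `(f, f⁻¹)` where `f` is a holomorphic automorphism of `X`. -/
def holomorphicAutomorphisms : Set (C(X, X) × C(X, X)) :=
  {p | ContMDiff 𝓘(ℂ, E) 𝓘(ℂ, E) ω p.1 ∧ ContMDiff 𝓘(ℂ, E) 𝓘(ℂ, E) ω p.2 ∧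
    (∀ x, p.2 (p.1 x) = x) ∧ ∀ x, p.1 (p.2 x) = x}

variable [IsManifold 𝓘(ℂ, E) ω X] [FiniteDimensional ℂ E] [T2Space X] [LocallyCompactSpace X]

/-- A limit of automorphisms may fail to be invertible. Carrying the inverse along cures this, since
the two identities between the components pass to limits. -/
theorem isClosed_holomorphicAutomorphisms : IsClosed (holomorphicAutomorphisms E X) := by
  have hcomp : ∀ x, Continuous fun p : C(X, X) × C(X, X) => p.2 (p.1 x) := fun x => by fun_prop
  have hcomp' : ∀ x, Continuous fun p : C(X, X) × C(X, X) => p.1 (p.2 x) := fun x => by fun_prop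
  have h : holomorphicAutomorphisms E X =
      Prod.fst ⁻¹' {f : C(X, X) | ContMDiff 𝓘(ℂ, E) 𝓘(ℂ, E) ω f} ∩
      (Prod.snd ⁻¹' {f : C(X, X) | ContMDiff 𝓘(ℂ, E) 𝓘(ℂ, E) ω f} ∩
      ((⋂ x, {p | p.2 (p.1 x) = x}) ∩ ⋂ x, {p | p.1 (p.2 x) = x})) := by
    ext p
    simp [holomorphicAutomorphisms]
  rw [h]
  exact ((isClosed_setOf_contMDiff E X).preimage continuous_fst).inter
    (((isClosed_setOf_contMDiff E X).preimage continuous_snd).inter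
      ((isClosed_iInter fun x => isClosed_eq (hcomp x) continuous_const).inter
        (isClosed_iInter fun x => isClosed_eq (hcomp' x) continuous_const)))

theorem baireSpace_pi_holomorphicAutomorphisms [SecondCountableTopology X] (m : ℕ) :
    BaireSpace (Fin m → holomorphicAutomorphisms E X) := by
  have := ContinuousMap.isCompletelyMetrizableSpace_of_locallyCompactSpace (X := X)
  have := (isClosed_holomorphicAutomorphisms E
    X).isClosedEmbedding_subtypeVal.IsCompletelyMetrizableSpace
  infer_instance

end HolomorphicAutomorphisms

/-! ### Order of vanishing along complex lines -/

section DirectionalDerivatives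

variable {E : Type*} [NormedAddCommGroup E] [NormedSpace ℂ E]

/-- The `k`-th iterated directional derivative of `h` in the direction `w`. -/
noncomputable def iteratedDirDeriv (w : E) (h : E → ℂ) : ℕ → E → ℂ
  | 0 => h
  | k + 1 => fun y => fderiv ℂ (iteratedDirDeriv w h k) y w

theorem analyticOnNhd_iteratedDirDeriv {w : E} {h : E → ℂ} {U : Set E} (hh : AnalyticOnNhd ℂ h U)
    (k : ℕ) : AnalyticOnNhd ℂ (iteratedDirDeriv w h k) U := by
  induction k with
  | zero => exact hh
  | succ k ih =>
    exact fun y hy => ((ContinuousLinearMap.apply ℂ ℂ w).analyticAt _).comp (ih.fderiv y hy)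

theorem iteratedDeriv_comp_line {w : E} {h : E → ℂ} {U : Set E} (hh : AnalyticOnNhd ℂ h U)
    (hU : IsOpen U) (p : E) (k : ℕ) : ∀ z : ℂ, p + z • w ∈ U →
    iteratedDeriv k (fun z : ℂ => h (p + z • w)) z = iteratedDirDeriv w h k (p + z • w) := by
  have hcont : Continuous fun z : ℂ => p + z • w := by fun_prop
  induction k with
  | zero => simp [iteratedDirDeriv]
  | succ k ih =>
    intro z hz
    have h1 : iteratedDeriv k (fun z : ℂ => h (p + z • w)) =ᶠ[𝓝 z]
        fun z => iteratedDirDeriv w h k (p + z • w) :=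
      Filter.eventually_of_mem (hcont.continuousAt.preimage_mem_nhds (hU.mem_nhds hz)) ih
    rw [iteratedDeriv_succ, h1.deriv_eq]
    have h2 : HasDerivAt (fun z : ℂ => p + z • w) w z := by
      simpa using ((hasDerivAt_id z).smul_const w).const_add p
    exact ((analyticOnNhd_iteratedDirDeriv hh k _ hz).differentiableAt.hasFDerivAt.comp_hasDerivAt
      z h2).deriv

/-- Otherwise the Taylor series of `h` along the complex line through `p` and `p + w` vanishes, and
so does `h` on the slice of `U` by this line, which is connected by convexity. -/
theorem exists_iteratedDirDeriv_ne_zero {w : E} {h : E → ℂ} {U : Set E}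
    (hh : AnalyticOnNhd ℂ h U) (hU : IsOpen U) (hconv : Convex ℝ U) {p : E} (hp : p ∈ U)
    (hpw : p + w ∈ U) (hne : h (p + w) ≠ 0) : ∃ k, iteratedDirDeriv w h k p ≠ 0 := by
  by_contra! H
  have hcont : Continuous fun z : ℂ => p + z • w := by fun_prop
  let Z : Set ℂ := (fun z : ℂ => p + z • w) ⁻¹' U
  have hZ : IsOpen Z := hU.preimage hcont
  have h0 : (0 : ℂ) ∈ Z := by simpa [Z] using hp
  have h1 : (1 : ℂ) ∈ Z := by simpa [Z] using hpw
  have hφ : AnalyticOnNhd ℂ (fun z : ℂ => h (p + z • w)) Z := fun z hz =>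
    (hh _ hz).comp (f := fun z : ℂ => p + z • w)
      (analyticAt_const.add (analyticAt_id.smul analyticAt_const))
  have hZc : IsPreconnected Z := by
    refine Convex.isPreconnected fun z₁ hz₁ z₂ hz₂ a b ha hb hab => ?_
    have h2 := hconv hz₁ hz₂ ha hb hab
    change p + (a • z₁ + b • z₂) • w ∈ U
    convert h2 using 1
    rw [smul_add, smul_add, add_add_add_comm, ← add_smul, hab, one_smul, add_smul]
    simp only [smul_assoc]
  have hev : (fun z : ℂ => h (p + z • w)) =ᶠ[𝓝 0] 0 := by
    obtain ⟨r, hr, hball⟩ := Metric.isOpen_iff.1 hZ 0 h0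
    filter_upwards [Metric.ball_mem_nhds (0 : ℂ) hr] with z hz
    have h2 := Complex.hasSum_taylorSeries_on_ball (hφ.differentiableOn.mono hball) hz
    have h3 : ∀ k, iteratedDeriv k (fun z : ℂ => h (p + z • w)) 0 = 0 := fun k => by
      rw [iteratedDeriv_comp_line hh hU p k 0 h0]
      simpa using H k
    simp only [h3, smul_zero] at h2
    exact h2.unique hasSum_zero
  exact hne (by simpa using hφ.eqOn_zero_of_preconnected_of_eventuallyEq_zero hZc h0 hev h1)

/-- At a zero of a nonzero holomorphic function `h`, some iterated directional derivative of `h`,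
in one of the directions of a given dense set, vanishes to order exactly one. -/
theorem exists_iteratedDirDeriv_eq_zero_and_ne_zero {h : E → ℂ} {U D : Set E}
    (hD : Dense D) (hh : AnalyticOnNhd ℂ h U) (hU : IsOpen U) (hconv : Convex ℝ U)
    (hne : ∃ y ∈ U, h y ≠ 0) {p : E} (hp : p ∈ U) (hzero : h p = 0) :
    ∃ w ∈ D, ∃ k, iteratedDirDeriv w h k p = 0 ∧ iteratedDirDeriv w h (k + 1) p ≠ 0 := by
  have hcont : Continuous fun w : E => p + w := by fun_prop
  have hopen : IsOpen (U ∩ h ⁻¹' {0}ᶜ) :=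
    hh.continuousOn.isOpen_inter_preimage hU isOpen_compl_singleton
  obtain ⟨y, hyU, hy⟩ := hne
  obtain ⟨w, ⟨hwU, hw⟩, hwD⟩ := hD.inter_open_nonempty _ (hopen.preimage hcont)
    ⟨y - p, by simpa using ⟨hyU, hy⟩⟩
  refine ⟨w, hwD, ?_⟩
  by_contra! H
  obtain ⟨k, hk⟩ := exists_iteratedDirDeriv_ne_zero hh hU hconv hp hwU hw
  have hall : ∀ k, iteratedDirDeriv w h k p = 0 := fun k => by
    induction k with
    | zero => exact hzero
    | succ k ih => exact H k ih
  exact hk (hall k)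

end DirectionalDerivatives

/-! ### The degeneracy locus as a countable union of hypersurface pieces -/

section Thin

variable {E : Type*} [NormedAddCommGroup E] [NormedSpace ℂ E]
  {X : Type*} [TopologicalSpace X] [ChartedSpace E X]

/-- A compact set which near each of its points lies in a smooth complex hypersurface. -/
def IsCompactInHypersurface (E : Type*) [NormedAddCommGroup E] [NormedSpace ℂ E]
    {X : Type*} [TopologicalSpace X] [ChartedSpace E X] (P : Set X) : Prop :=
  IsCompact P ∧ ∀ p ∈ P, ∃ g : X → ℂ, ContMDiffAt 𝓘(ℂ, E) 𝓘(ℂ, ℂ) ω g p ∧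
    (mfderiv 𝓘(ℂ, E) 𝓘(ℂ, ℂ) g p : E →L[ℂ] ℂ) ≠ 0 ∧ ∀ x ∈ P, g x = 0

variable [IsManifold 𝓘(ℂ, E) ω X]

/-- A lower bound `c` on the derivative, instead of mere nonvanishing, is a closed condition and
makes the piece compact. The single function `f`, read in the chart, serves as equation at all its
points. -/
theorem isCompactInHypersurface_image_extChartAt_symm [FiniteDimensional ℂ E] {q : X} {a : E}
    {R c : ℝ} (hc : 0 < c) (hball : Metric.closedBall a R ⊆ (extChartAt 𝓘(ℂ, E) q).target)
    {f : E → ℂ} {w : E} (hf : AnalyticOnNhd ℂ f (Metric.closedBall a R)) :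
    IsCompactInHypersurface E ((extChartAt 𝓘(ℂ, E) q).symm ''
      {y | y ∈ Metric.closedBall a R ∧ f y = 0 ∧ c ≤ ‖fderiv ℂ f y w‖}) := by
  have : CompleteSpace E := FiniteDimensional.complete ℂ E
  have : ProperSpace E := FiniteDimensional.proper ℂ E
  set e := extChartAt 𝓘(ℂ, E) q
  refine ⟨?_, ?_⟩
  · refine IsCompact.image_of_continuousOn ?_ ((continuousOn_extChartAt_symm q).mono
      fun y hy => hball hy.1)
    have h1 : IsClosed {y | y ∈ Metric.closedBall a R ∧ f y = 0} :=
      hf.continuousOn.preimage_isClosed_of_isClosed Metric.isClosed_closedBall isClosed_singleton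
    have h2 : ContinuousOn (fun y => ‖fderiv ℂ f y w‖) (Metric.closedBall a R) :=
      (hf.fderiv.continuousOn.clm_apply continuousOn_const).norm
    have h3 : IsClosed {y | y ∈ Metric.closedBall a R ∧ c ≤ ‖fderiv ℂ f y w‖} :=
      h2.preimage_isClosed_of_isClosed Metric.isClosed_closedBall isClosed_Ici
    refine (isCompact_closedBall a R).of_isClosed_subset (s := Metric.closedBall a R) ?_
      fun y hy => hy.1
    convert h1.inter h3 using 1
    ext y
    simp only [Set.mem_ofPred_eq, Set.mem_inter_iff]
    tauto
  · rintro _ ⟨y, ⟨hy, hy0, hyc⟩, rfl⟩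
    have hsrc : e.symm y ∈ e.source := e.map_target (hball hy)
    have hf' : ContMDiffAt 𝓘(ℂ, E) 𝓘(ℂ, ℂ) ω f (e (e.symm y)) := by
      rw [e.right_inv (hball hy)]
      exact (hf y hy).contDiffAt.contMDiffAt
    have he : ContMDiffAt 𝓘(ℂ, E) 𝓘(ℂ, E) ω e (e.symm y) :=
      contMDiffAt_extChartAt' (by rwa [← extChartAt_source 𝓘(ℂ, E)])
    refine ⟨f ∘ e, hf'.comp _ he, ?_, ?_⟩
    · intro h0
      have hsymm : ContMDiffAt 𝓘(ℂ, E) 𝓘(ℂ, E) ω e.symm y :=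
        (contMDiffOn_extChartAt_symm q).contMDiffAt
          ((isOpen_extChartAt_target q).mem_nhds (hball hy))
      have h1 : HasMFDerivAt 𝓘(ℂ, E) 𝓘(ℂ, ℂ) ((f ∘ e) ∘ e.symm) y _ :=
        HasMFDerivAt.comp y ((hf'.comp _ he).mdifferentiableAt (by simp)).hasMFDerivAt
        (hsymm.mdifferentiableAt (by simp)).hasMFDerivAt
      have h2 : f =ᶠ[𝓝 y] (f ∘ e) ∘ e.symm := by
        filter_upwards [(isOpen_extChartAt_target q).mem_nhds (hball hy)] with z hz
        exact (congrArg f (e.right_inv hz)).symm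
      have h3 : ((mfderiv 𝓘(ℂ, E) 𝓘(ℂ, ℂ) (f ∘ e) (e.symm y) : E →L[ℂ] ℂ) ∘L
          (mfderiv 𝓘(ℂ, E) 𝓘(ℂ, E) e.symm y : E →L[ℂ] E) : E →L[ℂ] ℂ) = 0 := by
        rw [h0]
        exact ContinuousLinearMap.zero_comp _
      have h4 : HasFDerivAt f (0 : E →L[ℂ] ℂ) y :=
        (h1.hasFDerivAt.congr_of_eventuallyEq h2).congr_fderiv h3
      rw [h4.fderiv] at hyc
      exact absurd (hyc.trans_eq norm_zero) (not_le.2 hc)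
    · rintro _ ⟨z, ⟨hz, hz0, -⟩, rfl⟩
      simp [Function.comp, e.right_inv (hball hz), hz0]

/-- The determinant of the fields `v i` in the chart at `q`. -/
noncomputable def coordDet [FiniteDimensional ℂ E] (q : X)
    (v : Fin (Module.finrank ℂ E) → (x : X) → TangentSpace 𝓘(ℂ, E) x) (y : E) : ℂ :=
  (Module.finBasis ℂ E).det fun i => coordField q (v i) y

theorem analyticOnNhd_coordDet [FiniteDimensional ℂ E]
    {v : Fin (Module.finrank ℂ E) → (x : X) → TangentSpace 𝓘(ℂ, E) x}
    (hv : ∀ i, IsHolomorphicVectorField (v i)) (q : X) :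
    AnalyticOnNhd ℂ (coordDet q v) (extChartAt 𝓘(ℂ, E) q).target := by
  have : CompleteSpace E := FiniteDimensional.complete ℂ E
  intro y hy
  unfold coordDet
  simp only [Module.Basis.det_apply, Matrix.det_apply', Module.Basis.toMatrix_apply]
  refine Finset.analyticAt_fun_sum _ fun σ _ => analyticAt_const.mul
    (Finset.analyticAt_fun_prod _ fun i _ => ?_)
  exact ((LinearMap.toContinuousLinearMap ((Module.finBasis ℂ E).coord (σ i))).analyticAt _).comp
    ((hv i).analyticOnNhd_coordField q y hy)

theorem span_eq_top_iff_coordDet_ne_zero [FiniteDimensional ℂ E]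
    (v : Fin (Module.finrank ℂ E) → (x : X) → TangentSpace 𝓘(ℂ, E) x) {q x : X}
    (hx : x ∈ (extChartAt 𝓘(ℂ, E) q).source) :
    Submodule.span ℂ (Set.range fun i => v i x) = ⊤ ↔
      coordDet q v (extChartAt 𝓘(ℂ, E) q x) ≠ 0 := by
  obtain ⟨L, hL⟩ : ∃ L : TangentSpace 𝓘(ℂ, E) x ≃L[ℂ] E,
      (L : TangentSpace 𝓘(ℂ, E) x →L[ℂ] E) =
        mfderiv 𝓘(ℂ, E) 𝓘(ℂ, E) (extChartAt 𝓘(ℂ, E) q) x :=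
    isInvertible_mfderiv_extChartAt (I := 𝓘(ℂ, E)) hx
  have h1 : (fun i => coordField q (v i) (extChartAt 𝓘(ℂ, E) q x)) =
      fun i => L (v i x) := by
    funext i
    rw [coordField_extChartAt _ hx]
    exact (DFunLike.congr_fun hL (v i x)).symm
  have h2 : coordDet q v (extChartAt 𝓘(ℂ, E) q x) = (Module.finBasis ℂ E).det fun i => L (v i x) :=
    congrArg (Module.finBasis ℂ E).det h1
  rw [h2, ← isUnit_iff_ne_zero, ← Module.Basis.is_basis_iff_det]
  have h3 : Submodule.span ℂ (Set.range fun i => (L (v i x) : E)) =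
      (Submodule.span ℂ (Set.range fun i => v i x)).map L.toLinearEquiv.toLinearMap := by
    rw [← Submodule.span_image, ← Set.range_comp]
    rfl
  have h4 : Submodule.span ℂ (Set.range fun i => (L (v i x) : E)) = ⊤ ↔
      Submodule.span ℂ (Set.range fun i => v i x) = ⊤ := by
    rw [h3]
    exact Submodule.map_eq_top_iff
  rw [← h4]
  refine ⟨fun h => ⟨linearIndependent_of_top_le_span_of_card_eq_finrank h.ge (by simp), h⟩,
    fun h => h.2⟩

/-- Identity theorem: the interior is also closed, because near a point of its closure the
determinant vanishes on an open set, hence on a whole coordinate ball. Connectedness and `x₀`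
exclude all of `X`. -/
theorem interior_setOf_span_ne_top_eq_empty [FiniteDimensional ℂ E] [ConnectedSpace X]
    {v : Fin (Module.finrank ℂ E) → (x : X) → TangentSpace 𝓘(ℂ, E) x}
    (hv : ∀ i, IsHolomorphicVectorField (v i))
    {x₀ : X} (hx₀ : Submodule.span ℂ (Set.range fun i => v i x₀) = ⊤) :
    interior {x | Submodule.span ℂ (Set.range fun i => v i x) ≠ ⊤} = ∅ := by
  set A := {x | Submodule.span ℂ (Set.range fun i => v i x) ≠ ⊤} with hA
  have hclopen : IsClopen (interior A) := by
    refine ⟨isClosed_of_closure_subset fun p hp => ?_, isOpen_interior⟩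
    set e := extChartAt 𝓘(ℂ, E) p
    obtain ⟨R, hR, hball⟩ := Metric.mem_nhds_iff.1
      ((isOpen_extChartAt_target (I := 𝓘(ℂ, E)) p).mem_nhds (mem_extChartAt_target p))
    have hnear : ∀ᶠ x in 𝓝 p, x ∈ e.source ∧ e x ∈ Metric.ball (e p) R :=
      Filter.Eventually.and ((isOpen_extChartAt_source p).mem_nhds (mem_extChartAt_source p))
        ((continuousAt_extChartAt p).eventually (Metric.ball_mem_nhds _ hR))
    obtain ⟨x, hxA, hxs, hxR⟩ := ((mem_closure_iff_frequently.1 hp).and_eventually hnear).exists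
    have hzero : coordDet p v =ᶠ[𝓝 (e x)] 0 := by
      have h1 : ContinuousAt e.symm (e x) := continuousAt_extChartAt_symm' hxs
      have h2 : interior A ∈ 𝓝 (e.symm (e x)) := by
        rw [e.left_inv hxs]
        exact isOpen_interior.mem_nhds hxA
      filter_upwards [h1.preimage_mem_nhds h2, Metric.isOpen_ball.mem_nhds hxR] with y hy hyR
      by_contra hne
      refine interior_subset hy ((span_eq_top_iff_coordDet_ne_zero v (e.map_target (hball hyR))).2 ?_)
      rwa [e.right_inv (hball hyR)]
    have hB := ((analyticOnNhd_coordDet hv p).mono hball).eqOn_zero_of_preconnected_of_eventuallyEq_zero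
      (convex_ball _ _).isPreconnected hxR hzero
    refine mem_interior_iff_mem_nhds.2 (Filter.mem_of_superset hnear ?_)
    rintro z ⟨hzs, hzR⟩ hz
    exact (span_eq_top_iff_coordDet_ne_zero v hzs).1 hz (hB hzR)
  rcases isClopen_iff.1 hclopen with h | h
  · exact h
  · exact absurd hx₀ (interior_subset (h ▸ Set.mem_univ x₀ : x₀ ∈ interior A))

/-- The locus where `dim X` holomorphic vector fields fail to span is contained in a countable
union of compact subsets of complex hypersurfaces, unless it is everything. -/
theorem exists_countable_cover_setOf_span_ne_top [FiniteDimensional ℂ E] [ConnectedSpace X]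
    [SecondCountableTopology X]
    {v : Fin (Module.finrank ℂ E) → (x : X) → TangentSpace 𝓘(ℂ, E) x}
    (hv : ∀ i, IsHolomorphicVectorField (v i))
    {x₀ : X} (hx₀ : Submodule.span ℂ (Set.range fun i => v i x₀) = ⊤) :
    ∃ C : Set (Set X), C.Countable ∧ (∀ P ∈ C, IsCompactInHypersurface E P) ∧
      {x | Submodule.span ℂ (Set.range fun i => v i x) ≠ ⊤} ⊆ ⋃₀ C := by
  have : CompleteSpace E := FiniteDimensional.complete ℂ E
  have : ProperSpace E := FiniteDimensional.proper ℂ E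
  obtain ⟨D, hDc, hDd⟩ := TopologicalSpace.exists_countable_dense E
  have hR : ∀ q : X, ∃ R > 0, Metric.ball (extChartAt 𝓘(ℂ, E) q q) R ⊆
      (extChartAt 𝓘(ℂ, E) q).target := fun q => Metric.mem_nhds_iff.1
    ((isOpen_extChartAt_target (I := 𝓘(ℂ, E)) q).mem_nhds (mem_extChartAt_target q))
  choose R hR hball using hR
  have hclosed : ∀ q, Metric.closedBall (extChartAt 𝓘(ℂ, E) q q) (R q / 2) ⊆
      Metric.ball (extChartAt 𝓘(ℂ, E) q q) (R q) := fun q =>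
    Metric.closedBall_subset_ball (by linarith [hR q])
  let N : X → Set X := fun q => {x | x ∈ (extChartAt 𝓘(ℂ, E) q).source ∧
    extChartAt 𝓘(ℂ, E) q x ∈ Metric.ball (extChartAt 𝓘(ℂ, E) q q) (R q / 2)}
  have hN : ∀ q, N q ∈ 𝓝 q := fun q =>
    Filter.Eventually.and ((isOpen_extChartAt_source q).mem_nhds (mem_extChartAt_source q))
      ((continuousAt_extChartAt q).eventually (Metric.ball_mem_nhds _ (by linarith [hR q])))
  obtain ⟨Q, hQc, hQ⟩ := TopologicalSpace.countable_cover_nhds hN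
  -- The determinant may vanish to high order, so a piece is cut out by one of its directional
  -- derivatives that vanishes with nonzero next derivative. The indices are chart centre,
  -- direction, order and a bound `1 / (j + 1)`; countability forces the directions into a dense
  -- countable set.
  let piece : X × E × ℕ × ℕ → Set X := fun i => (extChartAt 𝓘(ℂ, E) i.1).symm ''
    {y | y ∈ Metric.closedBall (extChartAt 𝓘(ℂ, E) i.1 i.1) (R i.1 / 2) ∧
      iteratedDirDeriv i.2.1 (coordDet i.1 v) i.2.2.1 y = 0 ∧
      1 / ((i.2.2.2 : ℝ) + 1) ≤
        ‖fderiv ℂ (iteratedDirDeriv i.2.1 (coordDet i.1 v) i.2.2.1) y i.2.1‖}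
  refine ⟨piece '' (Q ×ˢ D ×ˢ Set.univ), ?_, ?_, ?_⟩
  · exact (hQc.prod (hDc.prod Set.countable_univ)).image _
  · rintro _ ⟨⟨q, w, k, j⟩, -, rfl⟩
    exact isCompactInHypersurface_image_extChartAt_symm (by positivity)
      ((hclosed q).trans (hball q))
      ((analyticOnNhd_iteratedDirDeriv (analyticOnNhd_coordDet hv q) k).mono
        ((hclosed q).trans (hball q)))
  · intro x hx
    obtain ⟨q, hq, hxq⟩ := Set.mem_iUnion₂.1 (hQ ▸ Set.mem_univ x : x ∈ ⋃ q ∈ Q, N q)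
    set e := extChartAt 𝓘(ℂ, E) q with he
    have hxB : e x ∈ Metric.closedBall (e q) (R q / 2) := Metric.ball_subset_closedBall hxq.2
    have hzero : coordDet q v (e x) = 0 := by
      by_contra hne
      exact hx ((span_eq_top_iff_coordDet_ne_zero v hxq.1).2 hne)
    have hne : ∃ y ∈ Metric.ball (e q) (R q), coordDet q v y ≠ 0 := by
      by_contra! H
      have h1 : q ∈ interior {x | Submodule.span ℂ (Set.range fun i => v i x) ≠ ⊤} := by
        refine mem_interior_iff_mem_nhds.2 (Filter.mem_of_superset (hN q) ?_)
        rintro z ⟨hzs, hzR⟩ hz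
        exact (span_eq_top_iff_coordDet_ne_zero v hzs).1 hz
          (H _ (hclosed q (Metric.ball_subset_closedBall hzR)))
      rw [interior_setOf_span_ne_top_eq_empty hv hx₀] at h1
      exact h1
    obtain ⟨w, hw, k, hk, hk'⟩ := exists_iteratedDirDeriv_eq_zero_and_ne_zero hDd
      ((analyticOnNhd_coordDet hv q).mono (hball q)) Metric.isOpen_ball (convex_ball _ _) hne
      (hclosed q hxB) hzero
    obtain ⟨j, hj⟩ := exists_nat_one_div_lt (norm_pos_iff.2 hk')
    exact ⟨_, ⟨(q, w, k, j), ⟨hq, hw, trivial⟩, rfl⟩,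
      ⟨e x, ⟨hxB, hk, hj.le⟩, e.left_inv hxq.1⟩⟩

end Thin

/-! ### Crossing times with a transverse hypersurface -/

section Implicit

variable {E : Type*} [NormedAddCommGroup E] [NormedSpace ℂ E] [FiniteDimensional ℂ E]

/-- The inverse function theorem for `(t, u) ↦ (H (t, u), u)`; `τ u` is the first component of the
local inverse at `(0, u)`. -/
theorem exists_implicit_fst {H : ℂ × E → ℂ} {a : E} (hH : ContDiffAt ℂ ω H (0, a))
    (h0 : H (0, a) = 0) (hne : fderiv ℂ H (0, a) (1, 0) ≠ 0) :
    ∃ τ : E → ℂ, ContDiffAt ℂ ω τ a ∧ ∀ᶠ p in 𝓝 ((0 : ℂ), a), H p = 0 → p.1 = τ p.2 := by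
  have : CompleteSpace E := FiniteDimensional.complete ℂ E
  let G : ℂ × E → ℂ × E := fun p => (H p, p.2)
  let L : ℂ × E →L[ℂ] ℂ × E := (fderiv ℂ H (0, a)).prod (ContinuousLinearMap.snd ℂ ℂ E)
  have hG : ContDiffAt ℂ ω G (0, a) := hH.prodMk contDiffAt_snd
  have hinj : Function.Injective (L : ℂ × E →ₗ[ℂ] ℂ × E) := by
    rw [← LinearMap.ker_eq_bot, LinearMap.ker_eq_bot']
    rintro ⟨t, u⟩ htu
    have hu : u = 0 := congrArg Prod.snd htu
    have ht : fderiv ℂ H (0, a) (t, u) = 0 := congrArg Prod.fst htu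
    have h1 : ((t, 0) : ℂ × E) = t • (1, 0) := by simp
    rw [hu, h1, map_smul, smul_eq_mul] at ht
    rw [(mul_eq_zero.1 ht).resolve_right hne, hu]
    rfl
  let L' : (ℂ × E) ≃L[ℂ] ℂ × E := (LinearEquiv.ofInjectiveEndo _ hinj).toContinuousLinearEquiv
  have hL : (L' : ℂ × E →L[ℂ] ℂ × E) = L := by
    ext p <;> rfl
  have hG' : HasFDerivAt G (L' : ℂ × E →L[ℂ] ℂ × E) (0, a) := by
    rw [hL]
    exact (hH.differentiableAt (by simp)).hasFDerivAt.prodMk hasFDerivAt_snd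
  have hinv : ContDiffAt ℂ ω (hG.localInverse hG' (by simp)) (0, a) := by
    have h1 := hG.to_localInverse hG' (by simp)
    have h2 : G (0, a) = (0, a) := by simp [G, h0]
    rwa [h2] at h1
  refine ⟨fun u => (hG.localInverse hG' (by simp) (0, u)).1, ?_, ?_⟩
  · exact contDiffAt_fst.comp a
      (hinv.comp a (f := fun u : E => ((0 : ℂ), u)) (contDiffAt_const.prodMk contDiffAt_id))
  · filter_upwards [(hG.hasStrictFDerivAt' hG' (by simp)).eventually_left_inverse] with p hp hp0
    have h1 : G p = (0, p.2) := by simp [G, hp0]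
    rw [h1] at hp
    exact (congrArg Prod.fst hp).symm

end Implicit

section Crossing

variable {E : Type*} [NormedAddCommGroup E] [NormedSpace ℂ E] [FiniteDimensional ℂ E]
  {X : Type*} [TopologicalSpace X] [ChartedSpace E X] [IsManifold 𝓘(ℂ, E) ω X] [T2Space X]
  {v : (x : X) → TangentSpace 𝓘(ℂ, E) x}

/-- The time at which the flow of `v` crosses a hypersurface `{g = 0}` transverse to `v` is
a holomorphic function of the starting point. -/
theorem IsCompleteVectorField.exists_crossing_time (hc : IsCompleteVectorField v)
    (hv : IsHolomorphicVectorField v) {g : X → ℂ} {p : X}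
    (hg : ContMDiffAt 𝓘(ℂ, E) 𝓘(ℂ, ℂ) ω g p) (hgp : g p = 0)
    (hne : (mfderiv 𝓘(ℂ, E) 𝓘(ℂ, ℂ) g p : E →L[ℂ] ℂ) (v p) ≠ 0) :
    ∃ τ : X → ℂ, ∃ r > 0, ∀ᶠ y in 𝓝 p, ContMDiffAt 𝓘(ℂ, E) 𝓘(ℂ, ℂ) ω τ y ∧
      ∀ t : ℂ, ‖t‖ < r → g (hc.flow t y) = 0 → t = τ y := by
  have : CompleteSpace E := FiniteDimensional.complete ℂ E
  set e := extChartAt 𝓘(ℂ, E) p with he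
  have hep : e.symm (e p) = p := extChartAt_to_inv p
  let H : ℂ × E → ℂ := fun q => g (hc.flow q.1 (e.symm q.2))
  have hsymm : ContMDiffAt 𝓘(ℂ, E) 𝓘(ℂ, E) ω e.symm (e p) :=
    (contMDiffOn_extChartAt_symm p).contMDiffAt
      ((isOpen_extChartAt_target p).mem_nhds (mem_extChartAt_target p))
  have hpair : ContMDiffAt 𝓘(ℂ, ℂ × E) (𝓘(ℂ, ℂ).prod 𝓘(ℂ, E)) ω
      (fun q : ℂ × E => (q.1, e.symm q.2)) (0, e p) :=
    (contDiffAt_fst.contMDiffAt).prodMk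
      (hsymm.comp ((0 : ℂ), e p) contDiffAt_snd.contMDiffAt)
  have hflow : ContMDiffAt 𝓘(ℂ, ℂ × E) 𝓘(ℂ, E) ω
      (fun q : ℂ × E => hc.flow q.1 (e.symm q.2)) (0, e p) :=
    (hc.contMDiff_flow hv _).comp ((0 : ℂ), e p) hpair
  have hH : ContDiffAt ℂ ω H (0, e p) := by
    refine ContMDiffAt.contDiffAt (ContMDiffAt.comp ((0 : ℂ), e p) (g := g) ?_ hflow)
    simpa [hep, hc.flow_zero] using hg
  have hH0 : H (0, e p) = 0 := by simp only [H, hep, hc.flow_zero, hgp]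
  -- The time derivative of `H` at `t = 0` is the derivative of `g` along `v` at `p`, nonzero by
  -- transversality.
  have hder : fderiv ℂ H (0, e p) (1, 0) ≠ 0 := by
    have h1 : HasDerivAt (fun t : ℂ => ((t, e p) : ℂ × E)) (1, 0) 0 :=
      (hasDerivAt_id (0 : ℂ)).prodMk (hasDerivAt_const _ _)
    have h2 := ((hH.differentiableAt (by simp)).hasFDerivAt.comp_hasDerivAt (0 : ℂ) h1)
    have h3 : (H ∘ fun t : ℂ => ((t, e p) : ℂ × E)) = fun t => g (hc.flow t p) := by
      funext t
      simp only [H, Function.comp, hep]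
    rw [h3] at h2
    have h4 : ∀ y, y = p → MDifferentiableAt 𝓘(ℂ, E) 𝓘(ℂ, ℂ) g y ∧
        (mfderiv 𝓘(ℂ, E) 𝓘(ℂ, ℂ) g y : E →L[ℂ] ℂ) (v y) ≠ 0 := by
      rintro _ rfl
      exact ⟨hg.mdifferentiableAt (by simp), hne⟩
    obtain ⟨h5, h6⟩ := h4 _ (hc.flow_zero p)
    have h7 := (HasMFDerivAt.comp (0 : ℂ) h5.hasMFDerivAt
      (hc.isEntireIntegralCurve_flow p 0)).hasFDerivAt
    have h8 := congrArg (fun A : ℂ →L[ℂ] ℂ => A 1) (h2.hasFDerivAt.unique h7)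
    intro h0
    rw [h0] at h8
    refine h6 ?_
    refine Eq.trans ?_ (h8.symm.trans ?_)
    · exact (congrArg (mfderiv 𝓘(ℂ, E) 𝓘(ℂ, ℂ) g (hc.flow 0 p))
        (one_smul ℂ (v (hc.flow 0 p)))).symm
    · exact smul_zero (1 : ℂ)
  obtain ⟨τ, hτ, hev⟩ := exists_implicit_fst hH hH0 hder
  have hτ' : ContMDiffAt 𝓘(ℂ, E) 𝓘(ℂ, ℂ) ω (τ ∘ e) p :=
    hτ.contMDiffAt.comp p contMDiffAt_extChartAt
  rw [nhds_prod_eq] at hev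
  obtain ⟨pa, hpa, pb, hpb, hab⟩ := Filter.eventually_prod_iff.1 hev
  obtain ⟨r, hr, hball⟩ := Metric.eventually_nhds_iff_ball.1 hpa
  refine ⟨τ ∘ e, r, hr, ?_⟩
  filter_upwards [(contMDiffAt_iff_contMDiffAt_nhds (by simp)).1 hτ',
    (continuousAt_extChartAt p).eventually hpb,
    (isOpen_extChartAt_source (I := 𝓘(ℂ, E)) p).mem_nhds (mem_extChartAt_source p)] with y hy hy' hys
  refine ⟨hy, fun t ht h0 => hab (hball t (by simpa using ht)) hy' ?_⟩
  simp only [H]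
  rwa [he, (extChartAt 𝓘(ℂ, E) p).left_inv hys]

end Crossing

/-! ### Perturbing automorphisms by flows -/

section Perturbation

variable {E : Type*} [NormedAddCommGroup E] [NormedSpace ℂ E] [FiniteDimensional ℂ E]
  {X : Type*} [TopologicalSpace X] [ChartedSpace E X] [IsManifold 𝓘(ℂ, E) ω X] [T2Space X]
  {v : (x : X) → TangentSpace 𝓘(ℂ, E) x}

/-- Composition with the flow, the inverse being composed with the flow at time `-t`. Joint
continuity of the flow, curried, gives continuity in the compact-open topology. -/
theorem exists_continuous_perturbation [LocallyCompactSpace X] (hc : IsCompleteVectorField v)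
    (hv : IsHolomorphicVectorField v) (a : holomorphicAutomorphisms E X) :
    ∃ F : ℂ → holomorphicAutomorphisms E X, Continuous F ∧ F 0 = a ∧
      ∀ t x, (F t).1.1 x = hc.flow t (a.1.1 x) := by
  let Φ : C(ℂ, C(X, X)) := ContinuousMap.curry ⟨_, (hc.contMDiff_flow hv).continuous⟩
  have hΦ : ∀ t x, Φ t x = hc.flow t x := fun t x => rfl
  have hsmooth : ∀ t, ContMDiff 𝓘(ℂ, E) 𝓘(ℂ, E) ω (Φ t) := fun t =>
    (hc.contMDiff_flow hv).comp (contMDiff_const.prodMk contMDiff_id)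
  refine ⟨fun t => ⟨((Φ t).comp a.1.1, a.1.2.comp (Φ (-t))), ?_, ?_, ?_, ?_⟩, ?_, ?_, ?_⟩
  · exact (hsmooth t).comp a.2.1
  · exact a.2.2.1.comp (hsmooth (-t))
  · intro x
    simp [hΦ, ← hc.flow_add hv, hc.flow_zero, a.2.2.2.1]
  · intro x
    simp [hΦ, ← hc.flow_add hv, hc.flow_zero, a.2.2.2.2]
  · refine Continuous.subtype_mk (Continuous.prodMk ?_ ?_) _
    · exact Φ.continuous.compCM continuous_const
    · exact continuous_const.compCM (Φ.continuous.comp continuous_neg)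
  · refine Subtype.ext (Prod.ext ?_ ?_) <;> ext x <;> simp [hΦ, hc.flow_zero]
  · intro t x
    rfl

omit [FiniteDimensional ℂ E] [IsManifold 𝓘(ℂ, E) ω X] [T2Space X] in
-- A nonzero functional cannot kill a spanning set; this supplies a field transverse to a
-- hypersurface.
theorem exists_field_mfderiv_ne_zero {S : Set ((x : X) → TangentSpace 𝓘(ℂ, E) x)}
    (hspan : SpansEachTangentSpace S) {g : X → ℂ} {p : X}
    (hg : (mfderiv 𝓘(ℂ, E) 𝓘(ℂ, ℂ) g p : E →L[ℂ] ℂ) ≠ 0) :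
    ∃ v ∈ S, (mfderiv 𝓘(ℂ, E) 𝓘(ℂ, ℂ) g p : E →L[ℂ] ℂ) (v p) ≠ 0 := by
  by_contra! H
  refine hg ?_
  have h1 : (Submodule.span ℂ ((fun v : (x : X) → TangentSpace 𝓘(ℂ, E) x => v p) '' S) :
      Submodule ℂ E) ≤ LinearMap.ker (mfderiv 𝓘(ℂ, E) 𝓘(ℂ, ℂ) g p : E →L[ℂ] ℂ).toLinearMap := by
    refine Submodule.span_le.2 ?_
    rintro _ ⟨v, hv, rfl⟩
    exact H v hv
  ext u
  exact h1 ((hspan p).symm ▸ Submodule.mem_top : u ∈ Submodule.span ℂ _)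

/-- A point whose image under `φ j` lies in the hypersurface piece `P j` for all of
`j = 0, …, dim X` can be moved out of one of them by a perturbation, uniformly nearby. -/
theorem exists_perturbation_avoiding [LocallyCompactSpace X]
    {S : Set ((x : X) → TangentSpace 𝓘(ℂ, E) x)}
    (hS : ∀ v ∈ S, IsHolomorphicVectorField v ∧ IsCompleteVectorField v)
    (hspan : SpansEachTangentSpace S)
    {P : Fin (Module.finrank ℂ E + 1) → Set X} (hP : ∀ j, IsCompactInHypersurface E (P j))
    {φ : Fin (Module.finrank ℂ E + 1) → holomorphicAutomorphisms E X} {x₀ : X}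
    (hx₀ : ∀ j, (φ j).1.1 x₀ ∈ P j) :
    ∃ W ∈ 𝓝 φ, ∃ N ∈ 𝓝 x₀, ∀ φ' ∈ W, ∀ W' ∈ 𝓝 φ', ∃ ψ ∈ W', ∀ x ∈ N, ∃ j, (ψ j).1.1 x ∉ P j := by
  have : CompleteSpace E := FiniteDimensional.complete ℂ E
  choose g hg hgne hgP using fun j => (hP j).2 _ (hx₀ j)
  choose v hvS hvne using fun j => exists_field_mfderiv_ne_zero hspan (hgne j)
  choose τ r hr hτ using fun j => (hS _ (hvS j)).2.exists_crossing_time (hS _ (hvS j)).1 (hg j)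
    (hgP j _ (hx₀ j)) (hvne j)
  choose F hFc hF0 hF using fun j => exists_continuous_perturbation (hS _ (hvS j)).2 (hS _ (hvS j)).1
  set e := extChartAt 𝓘(ℂ, E) x₀ with he
  have hev : ∀ᶠ q in 𝓝 (φ, x₀), ∀ j, ContMDiffAt 𝓘(ℂ, E) 𝓘(ℂ, ℂ) ω (τ j) ((q.1 j).1.1 q.2) ∧
      ∀ t : ℂ, ‖t‖ < r j → g j ((hS _ (hvS j)).2.flow t ((q.1 j).1.1 q.2)) = 0 →
        t = τ j ((q.1 j).1.1 q.2) := by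
    refine Filter.eventually_all.2 fun j => ?_
    have h1 : Continuous fun q : (Fin (Module.finrank ℂ E + 1) → holomorphicAutomorphisms E X) × X =>
        (q.1 j).1.1 q.2 :=
      (continuous_eval (F := C(X, X))).comp ((continuous_fst.comp (continuous_subtype_val.comp
        ((continuous_apply j).comp continuous_fst))).prodMk continuous_snd)
    exact (h1.tendsto (φ, x₀)).eventually (hτ j)
  rw [nhds_prod_eq] at hev
  obtain ⟨pa, hpa, pb, hpb, hab⟩ := Filter.eventually_prod_iff.1 hev
  have hnear : ∀ᶠ y in 𝓝 (e x₀), y ∈ e.target ∧ pb (e.symm y) := by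
    refine Filter.Eventually.and
      ((isOpen_extChartAt_target x₀).mem_nhds (mem_extChartAt_target x₀)) ?_
    refine (continuousAt_extChartAt_symm x₀).eventually ?_
    rwa [extChartAt_to_inv x₀]
  obtain ⟨R, hR, hball⟩ := Metric.eventually_nhds_iff_ball.1 hnear
  refine ⟨_, hpa, {x | x ∈ e.source ∧ e x ∈ Metric.ball (e x₀) R}, ?_, ?_⟩
  · exact Filter.Eventually.and
      ((isOpen_extChartAt_source x₀).mem_nhds (mem_extChartAt_source x₀))
      ((continuousAt_extChartAt x₀).eventually (Metric.ball_mem_nhds _ hR))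
  intro φ' hφ' W' hW'
  -- The vector of crossing times: the only small `t` that can send the point with coordinate `y`
  -- into every `P j` is `f y`.
  let f : E → Fin (Module.finrank ℂ E + 1) → ℂ := fun y j => τ j ((φ' j).1.1 (e.symm y))
  have hf : ContDiffOn ℝ 1 f (Metric.ball (e x₀) R) := by
    refine contDiffOn_pi.2 fun j y hy => ContDiffAt.contDiffWithinAt ?_
    have h1 : ContMDiffAt 𝓘(ℂ, E) 𝓘(ℂ, E) ω e.symm y :=
      (contMDiffOn_extChartAt_symm x₀).contMDiffAt
        ((isOpen_extChartAt_target x₀).mem_nhds (hball y hy).1)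
    have h2 : ContMDiffAt 𝓘(ℂ, E) 𝓘(ℂ, E) ω (fun y => (φ' j).1.1 (e.symm y)) y :=
      ((φ' j).2.1 _).comp y h1
    have h3 : ContMDiffAt 𝓘(ℂ, E) 𝓘(ℂ, ℂ) ω (fun y => τ j ((φ' j).1.1 (e.symm y))) y :=
      ContMDiffAt.comp y (g := τ j) (hab hφ' (hball y hy).2 j).1 h2
    exact (h3.contDiffAt.restrict_scalars ℝ).of_le (by simp)
  -- This is why `n + 1` automorphisms are used: a `C^1` image of a set of real dimension `2n` has
  -- dense complement in real dimension `2n + 2`.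
  have hdense : Dense (f '' Metric.ball (e x₀) R)ᶜ := by
    refine hf.dense_compl_image_of_dimH_lt_finrank (convex_ball _ _) subset_rfl ?_
    refine (dimH_mono (Set.subset_univ _)).trans_lt ?_
    rw [Real.dimH_univ_eq_finrank, finrank_real_of_complex, finrank_real_of_complex]
    simp only [Module.finrank_fin_fun]
    exact_mod_cast (by omega)
  let Ψ : (Fin (Module.finrank ℂ E + 1) → ℂ) →
      Fin (Module.finrank ℂ E + 1) → holomorphicAutomorphisms E X := fun t j => F j (φ' j) (t j)
  have hΨ : Continuous Ψ := continuous_pi fun j => (hFc j (φ' j)).comp (continuous_apply j)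
  have hΨ0 : Ψ 0 = φ' := funext fun j => hF0 j (φ' j)
  have hsmall : ∀ᶠ t in 𝓝 (0 : Fin (Module.finrank ℂ E + 1) → ℂ), Ψ t ∈ W' ∧ ∀ j, ‖t j‖ < r j := by
    refine Filter.Eventually.and ?_ (Filter.eventually_all.2 fun j => ?_)
    · exact hΨ.continuousAt.eventually_mem (by rwa [hΨ0])
    · have h1 : Continuous fun t : Fin (Module.finrank ℂ E + 1) → ℂ => ‖t j‖ := by fun_prop
      exact h1.continuousAt.eventually_lt_const (by simpa using hr j)
  obtain ⟨t, ⟨htW, htr⟩, htf⟩ := mem_closure_iff_nhds.1 (hdense 0) _ hsmall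
  refine ⟨Ψ t, htW, fun x hx => ?_⟩
  by_contra! H
  refine htf ⟨e x, hx.2, funext fun j => ?_⟩
  have h1 := hab hφ' (hball _ hx.2).2 j
  rw [e.left_inv hx.1] at h1
  simp only [f, e.left_inv hx.1]
  refine (h1.2 (t j) (htr j) (hgP j _ ?_)).symm
  rw [← hF]
  exact H j

end Perturbation

theorem Submodule.exists_fun_fin_finrank_of_span_eq_top {K M : Type*} [DivisionRing K]
    [AddCommGroup M] [Module K M] [FiniteDimensional K M] {s : Set M} (hs : span K s = ⊤) :
    ∃ f : Fin (Module.finrank K M) → M, (∀ i, f i ∈ s) ∧ span K (Set.range f) = ⊤ := by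
  obtain ⟨f, hfs, hf, -⟩ := exists_fun_fin_finrank_span_eq K s
  have hn : Module.finrank K M = Module.finrank K (span K s) := by rw [hs, finrank_top]
  refine ⟨f ∘ finCongr hn, fun i => hfs _, ?_⟩
  rw [(finCongr hn).surjective.range_comp, hf, hs]

/-! ### The Baire category argument -/

section Generic

variable {E : Type*} [NormedAddCommGroup E] [NormedSpace ℂ E]
  {X : Type*} [TopologicalSpace X] [ChartedSpace E X]

/-- The tuples of automorphisms mapping a common point of `K` into all the sets `P j`. -/
def commonHittingSet (E : Type*) [NormedAddCommGroup E] [NormedSpace ℂ E]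
    {X : Type*} [TopologicalSpace X] [ChartedSpace E X] {m : ℕ} (K : Set X) (P : Fin m → Set X) :
    Set (Fin m → holomorphicAutomorphisms E X) :=
  {φ | ∃ x ∈ K, ∀ j, (φ j).1.1 x ∈ P j}

/-- Projection along the compact factor `K` is a closed map. -/
theorem isClosed_commonHittingSet [LocallyCompactSpace X] {m : ℕ} {K : Set X} (hK : IsCompact K)
    {P : Fin m → Set X} (hP : ∀ j, IsClosed (P j)) : IsClosed (commonHittingSet E K P) := by
  have : CompactSpace K := isCompact_iff_compactSpace.1 hK
  have hcont : ∀ j, Continuous fun q : (Fin m → holomorphicAutomorphisms E X) × K =>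
      (q.1 j).1.1 q.2.1 := fun j =>
    (continuous_eval (F := C(X, X))).comp ((continuous_fst.comp (continuous_subtype_val.comp
      ((continuous_apply j).comp continuous_fst))).prodMk
        (continuous_subtype_val.comp continuous_snd))
  have h1 : IsClosed (⋂ j, (fun q : (Fin m → holomorphicAutomorphisms E X) × K =>
      (q.1 j).1.1 q.2.1) ⁻¹' P j) := isClosed_iInter fun j => (hP j).preimage (hcont j)
  have h2 := isClosedMap_fst_of_compactSpace _ h1
  convert h2 using 1
  ext φ
  simp [commonHittingSet]

variable [FiniteDimensional ℂ E] [IsManifold 𝓘(ℂ, E) ω X] [T2Space X] [SecondCountableTopology X]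

/-- For generic automorphisms `φ 0, …, φ n`, where `n = dim X`, no point is mapped by all of them
into a given countable union of pieces of hypersurfaces. -/
theorem exists_automorphisms_avoiding {S : Set ((x : X) → TangentSpace 𝓘(ℂ, E) x)}
    (hS : ∀ v ∈ S, IsHolomorphicVectorField v ∧ IsCompleteVectorField v)
    (hspan : SpansEachTangentSpace S) {C : Set (Set X)} (hC : C.Countable)
    (hCP : ∀ P ∈ C, IsCompactInHypersurface E P) :
    ∃ φ : Fin (Module.finrank ℂ E + 1) → holomorphicAutomorphisms E X,
      ∀ x, ∃ j, (φ j).1.1 x ∉ ⋃₀ C := by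
  have : ProperSpace E := FiniteDimensional.proper ℂ E
  have : LocallyCompactSpace X := ChartedSpace.locallyCompactSpace E X
  have := baireSpace_pi_holomorphicAutomorphisms E X (Module.finrank ℂ E + 1)
  have := hC.to_subtype
  obtain ⟨B, hBc, -, hB⟩ := TopologicalSpace.exists_countable_basis X
  have := hBc.to_subtype
  let ι := {i : B × (Fin (Module.finrank ℂ E + 1) → C) // IsCompact (closure i.1.1)}
  let bad : ι → Set (Fin (Module.finrank ℂ E + 1) → holomorphicAutomorphisms E X) := fun i =>
    commonHittingSet E (closure i.1.1.1) fun j => (i.1.2 j).1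
  have hbad : ∀ i, IsClosed (bad i) := fun i =>
    isClosed_commonHittingSet i.2 fun j => (hCP _ (i.1.2 j).2).1.isClosed
  -- Frontiers of closed sets are nowhere dense. Avoiding them, a tuple in some `bad i` lies in its
  -- interior, so only the bad sets localised near a common hit point need to be treated by
  -- perturbation.
  have hdense : Dense (⋂ i, (frontier (bad i))ᶜ) :=
    dense_iInter_of_isOpen (fun i => isClosed_frontier.isOpen_compl) fun i =>
      interior_eq_empty_iff_dense_compl.1 (interior_frontier (hbad i))
  have : Nonempty (Fin (Module.finrank ℂ E + 1) → holomorphicAutomorphisms E X) :=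
    ⟨fun _ => ⟨(ContinuousMap.id X, ContinuousMap.id X), contMDiff_id, contMDiff_id,
      fun _ => rfl, fun _ => rfl⟩⟩
  obtain ⟨φ, hφ⟩ := hdense.nonempty
  refine ⟨φ, fun x₀ => ?_⟩
  by_contra! H
  choose P hPC hP using H
  obtain ⟨W, hW, N, hN, hWN⟩ := exists_perturbation_avoiding hS hspan (fun j => hCP _ (hPC j)) hP
  obtain ⟨K, hK, hKN, hKc⟩ := local_compact_nhds hN
  obtain ⟨b, hb, hxb, hbK⟩ := hB.mem_nhds_iff.1 hK
  have hbK' : closure b ⊆ K := closure_minimal hbK hKc.isClosed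
  let i : ι := ⟨(⟨b, hb⟩, fun j => ⟨P j, hPC j⟩), hKc.of_isClosed_subset isClosed_closure hbK'⟩
  have hφi : φ ∈ bad i := ⟨x₀, subset_closure hxb, hP⟩
  have hint : φ ∈ interior (bad i) := by
    by_contra hnot
    refine Set.mem_iInter.1 hφ i ?_
    rw [(hbad i).frontier_eq]
    exact ⟨hφi, hnot⟩
  obtain ⟨ψ, hψ, hψN⟩ := hWN φ (mem_of_mem_nhds hW) _ (mem_interior_iff_mem_nhds.1 hint)
  obtain ⟨x, hx, hxP⟩ := hψ
  obtain ⟨j, hj⟩ := hψN x (hKN (hbK' hx))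
  exact hj (hxP j)

end Generic

/-! ### Assembly of the finite spanning family -/

theorem mainTheorem12
    {E : Type*} [NormedAddCommGroup E] [NormedSpace ℂ E] [FiniteDimensional ℂ E]
    {X : Type*} [TopologicalSpace X] [T2Space X] [SecondCountableTopology X] [ConnectedSpace X]
    [ChartedSpace E X] [IsManifold 𝓘(ℂ, E) ω X]
    (S : Set ((x : X) → TangentSpace 𝓘(ℂ, E) x))
    (hS : ∀ v ∈ S, IsHolomorphicVectorField v ∧ IsCompleteVectorField v)
    (hspan : SpansEachTangentSpace S) :
    ∃ T : Set ((x : X) → TangentSpace 𝓘(ℂ, E) x),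
      T.Finite ∧ (∀ v ∈ T, IsHolomorphicVectorField v ∧ IsCompleteVectorField v) ∧
        SpansEachTangentSpace T := by
  have : CompleteSpace E := FiniteDimensional.complete ℂ E
  obtain ⟨x₀⟩ := (inferInstance : Nonempty X)
  obtain ⟨v, hvS, hv⟩ : ∃ v : Fin (Module.finrank ℂ E) → (x : X) → TangentSpace 𝓘(ℂ, E) x,
      (∀ i, v i ∈ S) ∧ Submodule.span ℂ (Set.range fun i => v i x₀) = ⊤ := by
    have hx₀ : Submodule.span ℂ
        ((fun v : (x : X) → TangentSpace 𝓘(ℂ, E) x => (v x₀ : E)) '' S : Set E) =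
        (⊤ : Submodule ℂ E) := hspan x₀
    obtain ⟨f, hfS, hf⟩ := Submodule.exists_fun_fin_finrank_of_span_eq_top hx₀
    choose v hvS hvf using hfS
    exact ⟨v, hvS, (congrArg (fun u : Fin (Module.finrank ℂ E) → E =>
      Submodule.span ℂ (Set.range u)) (funext hvf)).trans hf⟩
  obtain ⟨C, hC, hCP, hcover⟩ := exists_countable_cover_setOf_span_ne_top
    (fun i => (hS _ (hvS i)).1) hv
  obtain ⟨φ, hφ⟩ := exists_automorphisms_avoiding hS hspan hC hCP
  -- At most `n (n + 1)` fields: at a given `x`, those pulled back by a `φ j` with `φ j x` outside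
  -- the cover already span.
  refine ⟨Set.range fun p : Fin (Module.finrank ℂ E + 1) × Fin (Module.finrank ℂ E) =>
    VectorField.mpullback 𝓘(ℂ, E) 𝓘(ℂ, E) (φ p.1).1.1 (v p.2), Set.finite_range _, ?_, ?_⟩
  · rintro _ ⟨⟨j, i⟩, rfl⟩
    obtain ⟨hf, hg, hgf, hfg⟩ := (φ j).2
    exact ⟨(hS _ (hvS i)).1.mpullback hf hg hgf hfg, (hS _ (hvS i)).2.mpullback hf hg hgf hfg⟩
  · intro x
    obtain ⟨j, hj⟩ := hφ x
    obtain ⟨hf, hg, hgf, hfg⟩ := (φ j).2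
    have h1 : Submodule.span ℂ (Set.range fun i => v i ((φ j).1.1 x)) = ⊤ := by
      by_contra hne
      exact hj (hcover hne)
    rw [eq_top_iff, ← span_mpullback_eq_top hf hg hgf hfg h1]
    refine Submodule.span_mono ?_
    rintro _ ⟨i, rfl⟩
    exact ⟨_, ⟨(j, i), rfl⟩, rfl⟩
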